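/- Let $(\Omega,\mathcal F,\mathsf P)$ be a probability space with a filtration $(\mathcal F_s)_{s\in[0,T]}$, let $0\le t<T$, and let $f=(f_s)_{s\in[0,T]}$ be a standard Wiener process that is $\mathcal F_s$-adapted and whose increments $f_u-f_s$ ($s<u$) are independent of $\mathcal F_s$. For $[a,b]\subseteq[0,T]$ let ${\rm M}_2([a,b])$ be the class of processes $\xi:[a,b]\times\Omega\to\mathbb R$ that are jointly measurable, $\mathcal F_s$-adapted, with $\xi_s$ independent of $f_v-f_u$ for $s\le u<v\le b$, and with $\int_a^b\mathsf E\,\xi_s^2\,ds<\infty$ and $\mathsf E\,\xi_s^2<\infty$ for all $s\in[a,b]$. Let ${\rm S}_2([a,b])$ be the class of mean-square continuous members of ${\rm M}_2([a,b])$. Below, $\{\tau_l\}_{l=0}^N$, $N=1,2,\dots$, is any sequence of partitions $a=\tau_0\le\dots\le\tau_N=b$ with mesh tending to $0$ as $N\to\infty$, $\Delta w_{\tau_l}=w_{\tau_{l+1}}-w_{\tau_l}$, and l.i.m. is the limit in $L^2(\mathsf P)$. For $\xi\in{\rm M}_2([a,b])$ and $w=f$ or $w_\tau=\tau$, the integral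 $\int_a^b\xi_\tau\,dw_\tau$ is the common value of $\mathop{\rm l.i.m.}_{N\to\infty}\sum_{j=0}^{N-1}\xi^{(N)}_{\tau_j}\Delta w_{\tau_j}$ over all sequences of step processes $\xi^{(N)}\in{\rm M}_2([a,b])$, constant w.p. 1 on each $[\tau_j,\tau_{j+1})$, with $\int_a^b\mathsf E|\xi^{(N)}_s-\xi_s|^2ds\to0$. Let $k\ge1$, let $\phi\in{\rm S}_2([t,T])$, let $\psi_1,\dots,\psi_k$ be continuous deterministic functions on $[t,T]$, and let, for each $l=1,\dots,k+1$, either $w^{(l)}_\tau=f_\tau$ or $w^{(l)}_\tau=\tau$. Let $$J[\phi,\psi^{(k)}]_{T,t}=\int_t^T\psi_1(t_1)\dots\int_t^{t_{k-1}}\psi_k(t_k)\int_t^{t_k}\phi_\tau\,dw^{(k+1)}_\tau\,dw^{(k)}_{t_k}\dots dw^{(1)}_{t_1}$$ be the iterated Ito stochastic integral (at each stage a version of the inner integral is used that, times its weight, is of class ${\rm M}_2$). Put $\hat I[\psi^{(0)}]_{T,s}=1$ and, for $1\le r\le k$ and $s\in[t,T]$, $$\hat I[\psi^{(r)}]_{T,s}=\mathop{\rm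 l.i.m.}_{N\to\infty}\sum_{l=0}^{N-1}\psi_r(\tau_l)\,\Delta w^{(r)}_{\tau_l}\,\hat I[\psi^{(r-1)}]_{T,\tau_{l+1}}\quad\text{(partitions of }[s,T]),$$ $$\hat J[\phi,\psi^{(k)}]_{T,t}=\mathop{\rm l.i.m.}_{N\to\infty}\sum_{l=0}^{N-1}\phi_{\tau_l}\,\Delta w^{(k+1)}_{\tau_l}\,\hat I[\psi^{(k)}]_{T,\tau_{l+1}}\quad\text{(partitions of }[t,T]),$$ where each limit is required to exist, and to be the same, for all partition sequences as above. Then the iterated Ito integral $J[\phi,\psi^{(k)}]_{T,t}$ exists, the integral $\hat J[\phi,\psi^{(k)}]_{T,t}$ (including all the integrals $\hat I$ entering its definition) exists, and $$J[\phi,\psi^{(k)}]_{T,t}=\hat J[\phi,\psi^{(k)}]_{T,t}\quad\text{with probability }1.$$ -/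

import Mathlib

open MeasureTheory ProbabilityTheory Filter Topology Set

namespace IterIto

section

variable {Ω : Type*} [mΩ : MeasurableSpace Ω]

/-- `f` is a standard Wiener process on the time interval `[0, T]` relative to the filtration `ℱ`:
it starts at `0`, has continuous paths, is adapted, and for `0 ≤ s ≤ u ≤ T` the increment
`f u - f s` is `N(0, u - s)`-distributed and independent of `ℱ s`.
Only the values of `f` and `ℱ` at times in `[0, T]` are constrained. -/
structure IsWiener (P : Measure Ω) (ℱ : Filtration ℝ mΩ) (T : ℝ) (f : ℝ → Ω → ℝ) : Prop where
  zero : ∀ᵐ ω ∂P, f 0 ω = 0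
  continuous_paths : ∀ᵐ ω ∂P, ContinuousOn (fun s => f s ω) (Icc 0 T)
  adapted : ∀ s ∈ Icc 0 T, Measurable[ℱ s] (f s)
  gaussian : ∀ s u : ℝ, 0 ≤ s → s ≤ u → u ≤ T →
    P.map (fun ω => f u ω - f s ω) = gaussianReal 0 (u - s).toNNReal
  indep : ∀ s u : ℝ, 0 ≤ s → s ≤ u → u ≤ T →
    Indep (MeasurableSpace.comap (fun ω => f u ω - f s ω) inferInstance) (ℱ s) P

/-- The class `M₂([a, b])`. -/
structure InM2 (P : Measure Ω) (ℱ : Filtration ℝ mΩ) (f : ℝ → Ω → ℝ) (a b : ℝ)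
    (ξ : ℝ → Ω → ℝ) : Prop where
  measurable : Measurable (fun p : Icc a b × Ω => ξ p.1 p.2)
  adapted : ∀ s ∈ Icc a b, Measurable[ℱ s] (ξ s)
  indep : ∀ s ∈ Icc a b, ∀ u v : ℝ, s ≤ u → u < v → v ≤ b →
    IndepFun (ξ s) (fun ω => f v ω - f u ω) P
  lintegral_lt_top : ∫⁻ s in Icc a b, ∫⁻ ω, ‖ξ s ω‖ₑ ^ 2 ∂P < ⊤
  memLp : ∀ s ∈ Icc a b, MemLp (ξ s) 2 P

/-- The class `S₂([a, b])`: mean-square continuous members of `M₂([a, b])`. -/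
structure InS2 (P : Measure Ω) (ℱ : Filtration ℝ mΩ) (f : ℝ → Ω → ℝ) (a b : ℝ)
    (ξ : ℝ → Ω → ℝ) : Prop where
  inM2 : InM2 P ℱ f a b ξ
  continuous : ∀ s ∈ Icc a b,
    Tendsto (fun u => eLpNorm (fun ω => ξ u ω - ξ s ω) 2 P) (𝓝[Icc a b] s) (𝓝 0)

/-- The two kinds of integrators: the Wiener process and time. -/
inductive Integrator
  | wiener
  | time

/-- The path `τ ↦ w_τ` of an integrator, for a given Wiener process `f`. -/
def Integrator.path (f : ℝ → Ω → ℝ) : Integrator → ℝ → Ω → ℝ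
  | .wiener => f
  | .time => fun s _ => s

/-- A sequence of partitions `a = τ_0^{(N)} ≤ τ_1^{(N)} ≤ … ≤ τ_N^{(N)} = b`, `N = 1, 2, …`, whose
mesh tends to `0`. Repeated points are allowed; they contribute zero increments to all sums below,
and they make the definition meaningful for `a = b`, where all sums vanish. -/
structure IsPartitionSeq (a b : ℝ) (τ : ℕ → ℕ → ℝ) : Prop where
  left : ∀ N, 1 ≤ N → τ N 0 = a
  right : ∀ N, 1 ≤ N → τ N N = b
  mono : ∀ N, 1 ≤ N → ∀ j < N, τ N j ≤ τ N (j + 1)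
  mesh : ∀ ε > 0, ∃ N₀, ∀ N ≥ N₀, ∀ j < N, 1 ≤ N → τ N (j + 1) - τ N j < ε

/-- `I` is the mean-square limit (l.i.m.) of the random variables `S N`. -/
def IsMSLim (P : Measure Ω) (S : ℕ → Ω → ℝ) (I : Ω → ℝ) : Prop :=
  MemLp I 2 P ∧ Tendsto (fun N => eLpNorm (fun ω => S N ω - I ω) 2 P) atTop (𝓝 0)

/-- `X N` are step processes of class `M₂([a, b])` along the partitions `τ N` that converge to `ξ`
in the sense that `∫_a^b E |X N s - ξ s|² ds → 0`. -/
structure IsStepApprox (P : Measure Ω) (ℱ : Filtration ℝ mΩ) (f : ℝ → Ω → ℝ) (a b : ℝ)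
    (ξ : ℝ → Ω → ℝ) (τ : ℕ → ℕ → ℝ) (X : ℕ → ℝ → Ω → ℝ) : Prop where
  partition : IsPartitionSeq a b τ
  inM2 : ∀ N, 1 ≤ N → InM2 P ℱ f a b (X N)
  step : ∀ N, 1 ≤ N → ∀ j < N, ∀ s ∈ Ico (τ N j) (τ N (j + 1)), X N s =ᵐ[P] X N (τ N j)
  tendsto : Tendsto (fun N => ∫⁻ s in Icc a b, ∫⁻ ω, ‖X N s ω - ξ s ω‖ₑ ^ 2 ∂P) atTop (𝓝 0)

/-- `I = ∫_a^b ξ_s dw_s` for the integrator `w`: the integrand is of class `M₂([a, b])`, it has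
approximating step processes, and for *every* choice of them the sums `∑ X(τ_j) Δw_{τ_j}` converge
to `I` in mean square. For the Wiener process this is the Ito integral. -/
def IsStochInt (P : Measure Ω) (ℱ : Filtration ℝ mΩ) (f : ℝ → Ω → ℝ) (w : Integrator) (a b : ℝ)
    (ξ : ℝ → Ω → ℝ) (I : Ω → ℝ) : Prop :=
  InM2 P ℱ f a b ξ ∧
  (∃ τ X, IsStepApprox P ℱ f a b ξ τ X) ∧
  ∀ τ X, IsStepApprox P ℱ f a b ξ τ X →
    IsMSLim P (fun N ω => ∑ j ∈ Finset.range N,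
      X N (τ N j) ω * (w.path f (τ N (j + 1)) ω - w.path f (τ N j) ω)) I

/-- `IsIterInt P ℱ f φ ψ w t q r s J` says that `J` is the iterated Ito integral
`∫_t^s ψ_q(t_q) ∫_t^{t_q} ψ_{q+1}(t_{q+1}) ⋯ ∫_t^{t_{q+r-1}} φ_τ dw^{(q+r)}_τ ⋯ dw^{(q)}_{t_q}`
with the `r` weights `ψ_q, …, ψ_{q+r-1}`, evaluated from the inside out. The process `Z` is a
version of the inner integral as a function of its upper limit. -/
def IsIterInt (P : Measure Ω) (ℱ : Filtration ℝ mΩ) (f : ℝ → Ω → ℝ) (φ : ℝ → Ω → ℝ)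
    (ψ : ℕ → ℝ → ℝ) (w : ℕ → Integrator) (t : ℝ) : ℕ → ℕ → ℝ → (Ω → ℝ) → Prop
  | q, 0, s, J => IsStochInt P ℱ f (w q) t s φ J
  | q, r + 1, s, J => ∃ Z : ℝ → Ω → ℝ,
      (∀ u ∈ Icc t s, IsIterInt P ℱ f φ ψ w t (q + 1) r u (Z u)) ∧
      IsStochInt P ℱ f (w q) t s (fun u ω => ψ q u * Z u ω) J

/-- `J = ∫_a^b φ_s dw_s θ_s`, the combined stochastic integral: for every sequence of partitions of
`[a, b]` with mesh tending to `0` the sums `∑ φ_{τ_l} Δw_{τ_l} θ_{τ_{l+1}}` converge to `J` in mean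
square. -/
def IsCombinedInt (P : Measure Ω) (f : ℝ → Ω → ℝ) (w : Integrator) (a b : ℝ)
    (φ θ : ℝ → Ω → ℝ) (J : Ω → ℝ) : Prop :=
  ∀ τ, IsPartitionSeq a b τ →
    IsMSLim P (fun N ω => ∑ l ∈ Finset.range N,
      φ (τ N l) ω * (w.path f (τ N (l + 1)) ω - w.path f (τ N l) ω) * θ (τ N (l + 1)) ω) J

/-- `IsHatI P f ψ w T r s I` says that `I` is `Î[ψ^{(r)}]_{T,s}`, defined by recursion on `r`:
`Î[ψ^{(0)}]_{T,s} = 1`, and `Î[ψ^{(r+1)}]_{T,s} = ∫_s^T ψ_{r+1}(u) dw^{(r+1)}_u Î[ψ^{(r)}]_{T,u}` is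
a combined integral. -/
def IsHatI (P : Measure Ω) (f : ℝ → Ω → ℝ) (ψ : ℕ → ℝ → ℝ) (w : ℕ → Integrator) (T : ℝ) :
    ℕ → ℝ → (Ω → ℝ) → Prop
  | 0, _, I => I =ᵐ[P] fun _ => 1
  | r + 1, s, I => ∃ Z : ℝ → Ω → ℝ,
      (∀ u ∈ Icc s T, IsHatI P f ψ w T r u (Z u)) ∧
      IsCombinedInt P f (w (r + 1)) s T (fun u _ => ψ (r + 1) u) Z I

/-- `J` is `Ĵ[φ, ψ^{(k)}]_{T,t} = ∫_t^T φ_s dw^{(k+1)}_s Î[ψ^{(k)}]_{T,s}`, a combined integral. -/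
def IsHatJ (P : Measure Ω) (f : ℝ → Ω → ℝ) (φ : ℝ → Ω → ℝ) (ψ : ℕ → ℝ → ℝ)
    (w : ℕ → Integrator) (t T : ℝ) (k : ℕ) (J : Ω → ℝ) : Prop :=
  ∃ Z : ℝ → Ω → ℝ, (∀ u ∈ Icc t T, IsHatI P f ψ w T k u (Z u)) ∧
    IsCombinedInt P f (w (k + 1)) t T φ Z J

end

end IterIto

/-! Processes are treated as curves in the Hilbert space L²(P), a filtration as an increasing family
of closed subspaces (`adaptedL2`), and an integrator as the operator x ↦ x · (w_d − w_c)
(`mulIncr`). The integral of step functions is bounded in the L² norm over time: by the Ito isometry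
for the Wiener process, by Cauchy–Schwarz for time (`exists_isL2Integrator`). It therefore extends
uniquely to L² limits of step functions (`IsIto`, `ito`). The convenient integrands are the
`IsRegular` curves: adapted, bounded and almost everywhere continuous. They are stable under
continuous weights, indicators and indefinite integration, and their left-point sums converge along
every partition sequence by bounded convergence.

Let `outerInt r` be the operator that sends an innermost integrand to its iterated integral with r
outer weights. It is linear and bounded on regular integrands. The value of Î at s is `outerInt`
applied to the last weight cut off to times ≥ s (`hatInt`).

The order of integration is exchanged in `exists_tendsto_combinedSum`. In the sum of φ(τ_l) Δw_l
Î(τ_{l+1}), the factor x_l = φ(τ_l) Δw_l is known at τ_{l+1}, exactly when the innermost integration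
in Î starts, so it may be moved inside all the integrals (`outerInt_ae_eq_mul`). By linearity the
sum becomes `outerInt` of the weight at u times the sum of those x_l with τ_{l+1} ≤ u. That inner
sum is a left-point sum for the integral of φ up to u. It converges for almost every u and stays
bounded, so continuity of `outerInt` identifies the limit as the iterated integral with one more
layer. The same argument with a deterministic φ gives the existence of each Î, by induction.

It remains to match the definitions with these L² objects: `isStochInt_iff` and `isIterInt_iff` for
Ito integrals, where `exists_measurable_version` supplies inner integrals of class M₂, and
`isCombinedInt_iff` and `isHatI_iff` for the combined ones. The two iterated expressions then agree
by unfolding (`outerInt_iterIntegrand`). -/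

namespace IterIto

open scoped ENNReal NNReal

/-! ### Bounded convergence in L². -/

section BoundedConvergence

variable {α H : Type*} [MeasurableSpace α] [NormedAddCommGroup H]

/-- Bounded convergence in `L²` on a finite measure space. -/
theorem tendsto_eLpNorm_two_zero_of_bounded {μ : Measure α} [IsFiniteMeasure μ]
    {F : ℕ → α → H} (hF : ∀ᶠ n in atTop, AEStronglyMeasurable (F n) μ) {M : ℝ}
    (hM : ∀ᶠ n in atTop, ∀ᵐ x ∂μ, ‖F n x‖ ≤ M)
    (h : ∀ᵐ x ∂μ, Tendsto (fun n => F n x) atTop (𝓝 0)) :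
    Tendsto (fun n => eLpNorm (F n) 2 μ) atTop (𝓝 0) := by
  obtain ⟨N, hN⟩ := eventually_atTop.1 (hF.and hM)
  rw [← tendsto_add_atTop_iff_nat N]
  have key : Tendsto (fun n => ∫⁻ x, ‖F (n + N) x‖ₑ ^ 2 ∂μ) atTop (𝓝 (∫⁻ _, 0 ∂μ)) := by
    refine tendsto_lintegral_of_dominated_convergence'
      (fun _ => ENNReal.ofReal M ^ 2) (fun n => ?_) (fun n => ?_) ?_ ?_
    · exact (hN (n + N) (by omega)).1.enorm.pow_const 2
    · filter_upwards [(hN (n + N) (by omega)).2] with x hx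
      gcongr
      rw [← ofReal_norm]
      exact ENNReal.ofReal_le_ofReal hx
    · rw [lintegral_const]
      exact ENNReal.mul_ne_top (by simp) (measure_ne_top _ _)
    · filter_upwards [h] with x hx
      have h1 : Tendsto (fun n => ‖F n x‖ₑ) atTop (𝓝 0) := by
        have := (continuous_enorm.tendsto (0 : H)).comp hx
        rwa [enorm_zero] at this
      simpa [Function.comp_def] using
        (ENNReal.Tendsto.pow (n := 2) h1).comp (tendsto_add_atTop_nat N)
  have h2 : ∀ n, eLpNorm (F n) 2 μ = (∫⁻ x, ‖F n x‖ₑ ^ 2 ∂μ) ^ (1 / 2 : ℝ) := by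
    intro n
    rw [eLpNorm_eq_lintegral_rpow_enorm_toReal (by norm_num) (by norm_num)]
    simp
  simp_rw [h2]
  have h3 := ((ENNReal.continuous_rpow_const (y := (1 / 2 : ℝ))).tendsto _).comp key
  simpa [Function.comp_def] using h3

end BoundedConvergence

/-! ### Partitions and step functions along them. -/

section Partition

variable {H : Type*} [NormedAddCommGroup H]

theorem exists_mem_Ico_of_mono {τ : ℕ → ℝ} {N : ℕ} (hm : ∀ j < N, τ j ≤ τ (j + 1)) {s : ℝ}
    (hs : s ∈ Ico (τ 0) (τ N)) : ∃ j < N, s ∈ Ico (τ j) (τ (j + 1)) := by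
  induction N with
  | zero => simp at hs
  | succ n ih =>
    by_cases h : s < τ n
    · obtain ⟨j, hj, hj'⟩ := ih (fun j hj => hm j (by omega)) ⟨hs.1, h⟩
      exact ⟨j, by omega, hj'⟩
    · exact ⟨n, by omega, not_lt.1 h, hs.2⟩

theorem le_of_mono_range {τ : ℕ → ℝ} {N : ℕ} (hm : ∀ j < N, τ j ≤ τ (j + 1)) {i j : ℕ}
    (hij : i ≤ j) (hj : j ≤ N) : τ i ≤ τ j := by
  induction j, hij using Nat.le_induction with
  | base => exact le_rfl
  | succ n hn ih => exact (ih (by omega)).trans (hm n (by omega))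

/-- A step function along a partition is evaluated by its only active term. -/
theorem sum_indicator_Ico_eq {τ : ℕ → ℝ} {N : ℕ} (hm : ∀ j < N, τ j ≤ τ (j + 1)) {s : ℝ} {j : ℕ}
    (hj : j < N) (hs : s ∈ Ico (τ j) (τ (j + 1))) (F : ℕ → H) :
    ∑ i ∈ Finset.range N, (Ico (τ i) (τ (i + 1))).indicator (fun _ => F i) s = F j := by
  rw [Finset.sum_eq_single j]
  · simp [indicator_of_mem hs]
  · intro i hi hij
    refine indicator_of_notMem (fun hi' => hij ?_) _
    have hi := Finset.mem_range.1 hi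
    rcases lt_trichotomy i j with h | h | h
    · have := le_of_mono_range hm (i := i + 1) (j := j) h (by omega)
      exact absurd hs.1 (not_le.2 (hi'.2.trans_le this))
    · exact h
    · have := le_of_mono_range hm (i := j + 1) (j := i) h (by omega)
      exact absurd hi'.1 (not_le.2 (hs.2.trans_le this))
  · intro h; exact absurd (Finset.mem_range.2 hj) h

theorem sum_indicator_Ico_eq_zero {τ : ℕ → ℝ} {N : ℕ} (hm : ∀ j < N, τ j ≤ τ (j + 1)) {s : ℝ}
    (hs : s ∉ Ico (τ 0) (τ N)) (F : ℕ → H) :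
    ∑ i ∈ Finset.range N, (Ico (τ i) (τ (i + 1))).indicator (fun _ => F i) s = 0 := by
  refine Finset.sum_eq_zero fun i hi => indicator_of_notMem (fun hi' => hs ?_) _
  have hi := Finset.mem_range.1 hi
  exact ⟨(le_of_mono_range hm (Nat.zero_le i) hi.le).trans hi'.1,
    hi'.2.trans_le (le_of_mono_range hm (i := i + 1) hi le_rfl)⟩

theorem norm_sum_indicator_Ico_le {τ : ℕ → ℝ} {N : ℕ} (hm : ∀ j < N, τ j ≤ τ (j + 1)) (s : ℝ)
    {F : ℕ → H} {M : ℝ} (hM : ∀ i < N, ‖F i‖ ≤ M) (hM0 : 0 ≤ M) :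
    ‖∑ i ∈ Finset.range N, (Ico (τ i) (τ (i + 1))).indicator (fun _ => F i) s‖ ≤ M := by
  by_cases hs : s ∈ Ico (τ 0) (τ N)
  · obtain ⟨j, hj, hj'⟩ := exists_mem_Ico_of_mono hm hs
    rw [sum_indicator_Ico_eq hm hj hj']
    exact hM j hj
  · rw [sum_indicator_Ico_eq_zero hm hs]
    simpa using hM0

namespace IsPartitionSeq

variable {a b : ℝ} {τ : ℕ → ℕ → ℝ}

theorem mem_Icc (h : IsPartitionSeq a b τ) {N : ℕ} (hN : 1 ≤ N) {j : ℕ} (hj : j ≤ N) :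
    τ N j ∈ Icc a b := by
  constructor
  · rw [← h.left N hN]; exact le_of_mono_range (h.mono N hN) (Nat.zero_le j) hj
  · rw [← h.right N hN]; exact le_of_mono_range (h.mono N hN) hj le_rfl

theorem le (h : IsPartitionSeq a b τ) : a ≤ b := by
  have := h.mem_Icc le_rfl (Nat.zero_le 1)
  exact this.1.trans this.2

/-- Guarantees that definitions quantifying over all partition sequences are not vacuous, so that
they determine their limits. -/
theorem uniform (hab : a ≤ b) : IsPartitionSeq a b (fun N j => a + (b - a) * (j / N)) where
  left N hN := by simp
  right N hN := by
    have : (N : ℝ) ≠ 0 := by positivity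
    field_simp; ring
  mono N hN j hj := by
    have : 0 ≤ b - a := by linarith
    gcongr
    simp
  mesh ε hε := by
    obtain ⟨n, hn⟩ := exists_nat_gt ((b - a) / ε)
    refine ⟨n, fun N hN j hj h1 => ?_⟩
    have hN0 : (0 : ℝ) < N := by positivity
    have hn' : (n : ℝ) ≤ N := by exact_mod_cast hN
    rw [div_lt_iff₀ hε] at hn
    have : a + (b - a) * (((j + 1 : ℕ) : ℝ) / N) - (a + (b - a) * (j / N)) = (b - a) / N := by
      push_cast; field_simp; ring
    rw [this, div_lt_iff₀ hN0]
    nlinarith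

/-- Left-point evaluations along partitions, together with the active interval. -/
theorem exists_active (h : IsPartitionSeq a b τ) {s : ℝ} (hs : s ∈ Ico a b) {δ : ℝ}
    (hδ : 0 < δ) : ∀ᶠ N in atTop, 1 ≤ N ∧ ∃ j < N, s ∈ Ico (τ N j) (τ N (j + 1)) ∧
      s - δ < τ N j ∧ τ N (j + 1) < s + δ := by
  obtain ⟨N₀, hN₀⟩ := h.mesh δ hδ
  filter_upwards [eventually_ge_atTop N₀, eventually_ge_atTop 1] with N hN hN1
  refine ⟨hN1, ?_⟩
  obtain ⟨j, hj, hj'⟩ := exists_mem_Ico_of_mono (h.mono N hN1) (s := s)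
    (by rwa [h.left N hN1, h.right N hN1])
  have := hN₀ N hN j hj hN1
  exact ⟨j, hj, hj', by linarith [hj'.2], by linarith [hj'.1]⟩

end IsPartitionSeq

end Partition

/-! ### Abstract L² integration of Hilbert-space-type curves against a bounded elementary integral.
-/

section Elementary

variable {H : Type*} [NormedAddCommGroup H] [NormedSpace ℝ H]

/-- Lebesgue measure on the time interval `[0, T]`. -/
noncomputable abbrev timeMeasure (T : ℝ) : Measure ℝ := volume.restrict (Icc 0 T)

/-- The graph of the elementary integral: the linear span of the pairs consisting of an elementary
step function `1_{[c, d)} x` and its integral `D c d x`, with `x` adapted at time `c`. -/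
def stepGraph (V : ℝ → Submodule ℝ H) (D : ℝ → ℝ → H → H) (T : ℝ) :
    Submodule ℝ ((ℝ → H) × H) :=
  Submodule.span ℝ {p | ∃ c d x, 0 ≤ c ∧ c ≤ d ∧ d ≤ T ∧ x ∈ V c ∧
    p = ((Ico c d).indicator (fun _ => x), D c d x)}

/-- `D` is an integrator for which the elementary integral is bounded in the `L²` norm. -/
structure IsL2Integrator (V : ℝ → Submodule ℝ H) (D : ℝ → ℝ → H → H) (T : ℝ) (K : ℝ≥0) :
    Prop where
  nonneg : 0 ≤ T
  mono : Monotone V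
  closed : ∀ s, IsClosed (V s : Set H)
  mem : ∀ c d x, 0 ≤ c → c ≤ d → d ≤ T → x ∈ V c → D c d x ∈ V d
  bound : ∀ p ∈ stepGraph V D T, ‖p.2‖ₑ ≤ K * eLpNorm p.1 2 (timeMeasure T)

/-- `X` is the integral of `g`, obtained from `L²` approximations by step functions. -/
def IsIto (V : ℝ → Submodule ℝ H) (D : ℝ → ℝ → H → H) (T : ℝ) (g : ℝ → H) (X : H) : Prop :=
  AEStronglyMeasurable g (timeMeasure T) ∧ ∃ p : ℕ → (ℝ → H) × H,
    (∀ n, p n ∈ stepGraph V D T) ∧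
    Tendsto (fun n => eLpNorm ((p n).1 - g) 2 (timeMeasure T)) atTop (𝓝 0) ∧
    Tendsto (fun n => (p n).2) atTop (𝓝 X)

variable {V : ℝ → Submodule ℝ H} {D : ℝ → ℝ → H → H} {T : ℝ} {K : ℝ≥0}

theorem stepGraph.stronglyMeasurable {p : (ℝ → H) × H} (hp : p ∈ stepGraph V D T) :
    StronglyMeasurable p.1 := by
  induction hp using Submodule.span_induction with
  | mem p hp =>
    obtain ⟨c, d, x, -, -, -, -, rfl⟩ := hp
    exact stronglyMeasurable_const.indicator measurableSet_Ico
  | zero => exact stronglyMeasurable_zero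
  | add p q _ _ hp hq => exact hp.add hq
  | smul r p _ hp => exact hp.const_smul r

theorem stepGraph.memLp {p : (ℝ → H) × H} (hp : p ∈ stepGraph V D T) :
    MemLp p.1 2 (timeMeasure T) := by
  induction hp using Submodule.span_induction with
  | mem p hp =>
    obtain ⟨c, d, x, -, -, -, -, rfl⟩ := hp
    exact (memLp_const x).indicator measurableSet_Ico
  | zero => exact MemLp.zero
  | add p q _ _ hp hq => exact hp.add hq
  | smul r p _ hp => exact hp.const_smul r

theorem mem_stepGraph {c d : ℝ} {x : H} (hc : 0 ≤ c) (hcd : c ≤ d) (hd : d ≤ T) (hx : x ∈ V c) :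
    ((Ico c d).indicator (fun _ => x), D c d x) ∈ stepGraph V D T :=
  Submodule.subset_span ⟨c, d, x, hc, hcd, hd, hx, rfl⟩

namespace IsIto

theorem of_mem {p : (ℝ → H) × H} (hp : p ∈ stepGraph V D T) : IsIto V D T p.1 p.2 :=
  ⟨(stepGraph.stronglyMeasurable hp).aestronglyMeasurable, fun _ => p, fun _ => hp, by simp,
    tendsto_const_nhds⟩

theorem add {g g' : ℝ → H} {X X' : H} (h : IsIto V D T g X) (h' : IsIto V D T g' X') :
    IsIto V D T (g + g') (X + X') := by
  obtain ⟨hg, p, hp, hpg, hpX⟩ := h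
  obtain ⟨hg', p', hp', hpg', hpX'⟩ := h'
  refine ⟨hg.add hg', fun n => p n + p' n, fun n => add_mem (hp n) (hp' n), ?_, hpX.add hpX'⟩
  refine tendsto_of_tendsto_of_tendsto_of_le_of_le tendsto_const_nhds
    (by simpa using hpg.add hpg') (fun _ => zero_le) fun n => ?_
  have : (p n + p' n).1 - (g + g') = ((p n).1 - g) + ((p' n).1 - g') := by
    simp only [Prod.fst_add]; abel
  simp only [this]
  exact eLpNorm_add_le ((stepGraph.stronglyMeasurable (hp n)).aestronglyMeasurable.sub hg)
    ((stepGraph.stronglyMeasurable (hp' n)).aestronglyMeasurable.sub hg') (by norm_num)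

theorem neg {g : ℝ → H} {X : H} (h : IsIto V D T g X) : IsIto V D T (-g) (-X) := by
  obtain ⟨hg, p, hp, hpg, hpX⟩ := h
  refine ⟨hg.neg, fun n => -p n, fun n => neg_mem (hp n), ?_, hpX.neg⟩
  refine hpg.congr fun n => ?_
  rw [← eLpNorm_neg]
  congr 1
  simp only [Prod.fst_neg]; abel

theorem sub {g g' : ℝ → H} {X X' : H} (h : IsIto V D T g X) (h' : IsIto V D T g' X') :
    IsIto V D T (g - g') (X - X') := by
  simpa only [sub_eq_add_neg] using h.add h'.neg

theorem congr {g g' : ℝ → H} {X : H} (h : IsIto V D T g X) (hg : g =ᵐ[timeMeasure T] g') :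
    IsIto V D T g' X := by
  obtain ⟨h1, p, hp, hpg, hpX⟩ := h
  refine ⟨h1.congr hg, p, hp, hpg.congr fun n => eLpNorm_congr_ae ?_, hpX⟩
  exact (EventuallyEq.refl _ _).sub hg

/-- The bound for step functions survives the limit because both sides are continuous under the
approximation. Uniqueness and all later convergence statements follow from it. -/
theorem enorm_le (hD : IsL2Integrator V D T K) {g : ℝ → H} {X : H} (h : IsIto V D T g X) :
    ‖X‖ₑ ≤ K * eLpNorm g 2 (timeMeasure T) := by
  obtain ⟨hg, p, hp, hpg, hpX⟩ := h
  have h1 : Tendsto (fun n => ‖(p n).2‖ₑ) atTop (𝓝 ‖X‖ₑ) := (continuous_enorm.tendsto X).comp hpX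
  have h2 : Tendsto (fun n => K * (eLpNorm ((p n).1 - g) 2 (timeMeasure T) +
      eLpNorm g 2 (timeMeasure T))) atTop (𝓝 (K * (0 + eLpNorm g 2 (timeMeasure T)))) :=
    ENNReal.Tendsto.const_mul (hpg.add tendsto_const_nhds) (Or.inr ENNReal.coe_ne_top)
  rw [zero_add] at h2
  refine le_of_tendsto_of_tendsto' h1 h2 fun n => (hD.bound _ (hp n)).trans ?_
  gcongr
  have : (p n).1 = ((p n).1 - g) + g := by abel
  conv_lhs => rw [this]
  exact eLpNorm_add_le ((stepGraph.stronglyMeasurable (hp n)).aestronglyMeasurable.sub hg) hg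
    (by norm_num)

theorem unique (hD : IsL2Integrator V D T K) {g : ℝ → H} {X X' : H} (h : IsIto V D T g X)
    (h' : IsIto V D T g X') : X = X' := by
  have := (h.sub h').enorm_le hD
  simp only [sub_self, eLpNorm_zero, mul_zero, nonpos_iff_eq_zero, enorm_eq_zero] at this
  exact sub_eq_zero.1 this

/-- Convergence of integrals from `L²` convergence of integrands. -/
theorem tendsto (hD : IsL2Integrator V D T K) {g : ℝ → H} {X : H} (h : IsIto V D T g X)
    {gs : ℕ → ℝ → H} {Xs : ℕ → H} (hs : ∀ᶠ n in atTop, IsIto V D T (gs n) (Xs n))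
    (hg : Tendsto (fun n => eLpNorm (gs n - g) 2 (timeMeasure T)) atTop (𝓝 0)) :
    Tendsto Xs atTop (𝓝 X) := by
  rw [tendsto_iff_edist_tendsto_0]
  have h2 : Tendsto (fun n => K * eLpNorm (gs n - g) 2 (timeMeasure T)) atTop (𝓝 0) := by
    simpa using ENNReal.Tendsto.const_mul hg (Or.inr (ENNReal.coe_ne_top (r := K)))
  refine tendsto_of_tendsto_of_tendsto_of_le_of_le' tendsto_const_nhds h2
    (Eventually.of_forall fun _ => zero_le) ?_
  filter_upwards [hs] with n hn
  rw [edist_eq_enorm_sub]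
  exact (hn.sub h).enorm_le hD

/-- Approximating step functions are Cauchy in L² over time, so boundedness makes their integrals
Cauchy, and completeness of H supplies the limit. -/
theorem exists_of_tendsto [CompleteSpace H] (hD : IsL2Integrator V D T K) {g : ℝ → H}
    (hg : AEStronglyMeasurable g (timeMeasure T)) {p : ℕ → (ℝ → H) × H}
    (hp : ∀ᶠ n in atTop, p n ∈ stepGraph V D T)
    (h : Tendsto (fun n => eLpNorm ((p n).1 - g) 2 (timeMeasure T)) atTop (𝓝 0)) :
    ∃ X, IsIto V D T g X := by
  obtain ⟨N, hN⟩ := eventually_atTop.1 hp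
  set q : ℕ → (ℝ → H) × H := fun n => p (n + N) with hq
  have hqm : ∀ n, q n ∈ stepGraph V D T := fun n => hN _ (by omega)
  have hqt : Tendsto (fun n => eLpNorm ((q n).1 - g) 2 (timeMeasure T)) atTop (𝓝 0) :=
    h.comp (tendsto_add_atTop_nat N)
  have hsm : ∀ n, AEStronglyMeasurable ((q n).1 - g) (timeMeasure T) := fun n =>
    (stepGraph.stronglyMeasurable (hqm n)).aestronglyMeasurable.sub hg
  have hc : CauchySeq fun n => (q n).2 := by
    rw [EMetric.cauchySeq_iff]
    intro ε hε
    have h2 : Tendsto (fun n => K * eLpNorm ((q n).1 - g) 2 (timeMeasure T)) atTop (𝓝 0) := by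
      simpa using ENNReal.Tendsto.const_mul hqt (Or.inr (ENNReal.coe_ne_top (r := K)))
    obtain ⟨n₀, hn₀⟩ := eventually_atTop.1 (h2.eventually (gt_mem_nhds (ENNReal.half_pos hε.ne')))
    refine ⟨n₀, fun m hm n hn => ?_⟩
    rw [edist_eq_enorm_sub]
    have h3 := hD.bound _ (sub_mem (hqm m) (hqm n))
    refine h3.trans_lt ?_
    have h4 : (q m - q n).1 = ((q m).1 - g) - ((q n).1 - g) := by
      simp only [Prod.fst_sub]; abel
    rw [h4]
    calc K * eLpNorm (((q m).1 - g) - ((q n).1 - g)) 2 (timeMeasure T)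
        ≤ K * (eLpNorm ((q m).1 - g) 2 (timeMeasure T) +
            eLpNorm ((q n).1 - g) 2 (timeMeasure T)) := by
          gcongr
          exact eLpNorm_sub_le (hsm m) (hsm n) (by norm_num)
      _ = K * eLpNorm ((q m).1 - g) 2 (timeMeasure T) +
            K * eLpNorm ((q n).1 - g) 2 (timeMeasure T) := mul_add _ _ _
      _ < ε / 2 + ε / 2 := ENNReal.add_lt_add (hn₀ m hm) (hn₀ n hn)
      _ = ε := ENNReal.add_halves ε
  obtain ⟨X, hX⟩ := cauchySeq_tendsto_of_complete hc
  exact ⟨X, hg, q, hqm, hqt, hX⟩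

end IsIto

open Classical in
/-- The integral of `g`, `0` if it does not exist. -/
noncomputable def ito (V : ℝ → Submodule ℝ H) (D : ℝ → ℝ → H → H) (T : ℝ) (g : ℝ → H) : H :=
  if h : ∃ X, IsIto V D T g X then h.choose else 0

theorem IsIto.ito_eq (hD : IsL2Integrator V D T K) {g : ℝ → H} {X : H} (h : IsIto V D T g X) :
    ito V D T g = X := by
  have h' : ∃ X, IsIto V D T g X := ⟨X, h⟩
  rw [ito, dif_pos h']
  exact h'.choose_spec.unique hD h

end Elementary

/-! ### Regular integrands, left-point sums and indefinite integrals. -/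

section Regular

/-- Bounded, almost everywhere continuous functions of time. -/
structure IsRiemann {H : Type*} [NormedAddCommGroup H] (ξ : ℝ → H) : Prop where
  bounded : ∃ M : ℝ, ∀ s, ‖ξ s‖ ≤ M
  ae_continuousAt : ∀ᵐ s, ContinuousAt ξ s

variable {H : Type*} [NormedAddCommGroup H]

/-- Off the null frontier, the indicator function coincides locally with ξ or with 0. -/
theorem ae_continuousAt_indicator {S : Set ℝ} (hS : volume (frontier S) = 0) {ξ : ℝ → H}
    (hξ : ∀ᵐ s, s ∈ interior S → ContinuousAt ξ s) : ∀ᵐ s, ContinuousAt (S.indicator ξ) s := by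
  have h1 : ∀ᵐ s, s ∉ frontier S := measure_eq_zero_iff_ae_notMem.1 hS
  filter_upwards [h1, hξ] with s hs hc
  by_cases h : s ∈ closure S
  · have hi : s ∈ interior S := by
      by_contra hi
      exact hs ⟨h, hi⟩
    refine (hc hi).congr ?_
    filter_upwards [mem_interior_iff_mem_nhds.1 hi] with x hx
    rw [indicator_of_mem hx]
  · refine (continuousAt_const (y := (0 : H))).congr ?_
    filter_upwards [isClosed_closure.isOpen_compl.mem_nhds h] with x hx
    rw [indicator_of_notMem (fun h' => hx (subset_closure h'))]

theorem IsRiemann.indicator {ξ : ℝ → H} (h : IsRiemann ξ) {S : Set ℝ}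
    (hS : volume (frontier S) = 0) : IsRiemann (S.indicator ξ) where
  bounded := by
    obtain ⟨M, hM⟩ := h.bounded
    exact ⟨M, fun s => (norm_indicator_le_norm_self _ _).trans (hM s)⟩
  ae_continuousAt := ae_continuousAt_indicator hS
    (h.ae_continuousAt.mono fun _ hs _ => hs)

theorem IsRiemann.of_continuousOn {a b : ℝ} {ξ : ℝ → H} (h : ContinuousOn ξ (Icc a b)) :
    IsRiemann ((Icc a b).indicator ξ) where
  bounded := by
    obtain ⟨M, hM⟩ := isCompact_Icc.exists_bound_of_continuousOn h
    refine ⟨max M 0, fun s => ?_⟩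
    by_cases hs : s ∈ Icc a b
    · rw [indicator_of_mem hs]; exact (hM s hs).trans (le_max_left _ _)
    · rw [indicator_of_notMem hs]; simp
  ae_continuousAt := by
    refine ae_continuousAt_indicator ?_ (Eventually.of_forall fun s hs =>
      h.continuousAt (mem_interior_iff_mem_nhds.1 hs))
    rcases le_or_gt a b with hab | hab
    · rw [frontier_Icc hab]; exact (Set.toFinite _).measure_zero _
    · rw [Icc_eq_empty (not_le.2 hab)]; simp

theorem IsRiemann.smul [NormedSpace ℝ H] {ρ : ℝ → ℝ} {ξ : ℝ → H} (hρ : IsRiemann ρ)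
    (h : IsRiemann ξ) : IsRiemann (fun s => ρ s • ξ s) where
  bounded := by
    obtain ⟨M, hM⟩ := h.bounded
    obtain ⟨R, hR⟩ := hρ.bounded
    refine ⟨R * M, fun s => ?_⟩
    rw [norm_smul]
    exact mul_le_mul (hR s) (hM s) (norm_nonneg _) ((norm_nonneg _).trans (hR s))
  ae_continuousAt := by
    filter_upwards [hρ.ae_continuousAt, h.ae_continuousAt] with s h1 h2
    exact h1.smul h2

/-- Pointwise convergence of left-point step functions stopped at time `u`. -/
theorem tendsto_leftStep {ξ : ℝ → H} {a b : ℝ} {τ : ℕ → ℕ → ℝ} (hτ : IsPartitionSeq a b τ) {s : ℝ}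
    (hc : ContinuousAt ξ s) (u : ℝ) (hsu : s ≠ u) :
    Tendsto (fun N => ∑ j ∈ Finset.range N, (Ico (τ N j) (τ N (j + 1))).indicator
      (fun _ => if τ N (j + 1) ≤ u then ξ (τ N j) else 0) s) atTop
      (𝓝 ((Iio u).indicator ((Ico a b).indicator ξ) s)) := by
  by_cases hs : s ∈ Ico a b
  swap
  · have : (Iio u).indicator ((Ico a b).indicator ξ) s = 0 := by
      simp [indicator_apply, hs]
    rw [this]
    refine tendsto_const_nhds.congr' ?_
    filter_upwards [eventually_ge_atTop 1] with N hN
    rw [sum_indicator_Ico_eq_zero (hτ.mono N hN) (by rwa [hτ.left N hN, hτ.right N hN])]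
  rcases lt_or_gt_of_ne hsu with hsu | hsu
  -- For s < u the active interval eventually ends before u, so the stopping condition holds and
  -- continuity at s applies. For s > u the active interval ends after u and contributes nothing.
  · have : (Iio u).indicator ((Ico a b).indicator ξ) s = ξ s := by
      rw [indicator_of_mem (show s ∈ Iio u from hsu), indicator_of_mem hs]
    rw [this, Metric.tendsto_atTop']
    intro ε hε
    obtain ⟨δ, hδ, hδ'⟩ := Metric.continuousAt_iff.1 hc ε hε
    obtain ⟨N₀, hN₀⟩ := eventually_atTop.1
      (hτ.exists_active hs (lt_min hδ (sub_pos.2 hsu)))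
    refine ⟨N₀, fun N hN => ?_⟩
    obtain ⟨hN1, j, hj, hj', h1, h2⟩ := hN₀ N hN.le
    rw [sum_indicator_Ico_eq (hτ.mono N hN1) hj hj', if_pos]
    · refine hδ' ?_
      rw [Real.dist_eq, abs_lt]
      have := min_le_left δ (u - s)
      constructor <;> linarith [hj'.1]
    · have := min_le_right δ (u - s)
      linarith
  · have : (Iio u).indicator ((Ico a b).indicator ξ) s = 0 :=
      indicator_of_notMem (by simpa using hsu.le) _
    rw [this]
    refine tendsto_const_nhds.congr' ?_
    filter_upwards [eventually_ge_atTop 1] with N hN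
    obtain ⟨j, hj, hj'⟩ := exists_mem_Ico_of_mono (hτ.mono N hN) (s := s)
      (by rwa [hτ.left N hN, hτ.right N hN])
    rw [sum_indicator_Ico_eq (hτ.mono N hN) hj hj', if_neg]
    exact not_le.2 (hsu.trans hj'.2)

theorem stronglyMeasurable_leftStep (τ : ℕ → ℝ) (x : ℕ → H) (N : ℕ) :
    StronglyMeasurable (fun s => ∑ j ∈ Finset.range N,
      (Ico (τ j) (τ (j + 1))).indicator (fun _ => x j) s) :=
  Finset.stronglyMeasurable_fun_sum _ fun _ _ =>
    stronglyMeasurable_const.indicator measurableSet_Ico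

variable [NormedSpace ℝ H]

/-- Adapted processes which are bounded and almost everywhere continuous as functions of time. -/
structure IsRegular (V : ℝ → Submodule ℝ H) (ξ : ℝ → H) : Prop extends IsRiemann ξ where
  adapted : ∀ s, ξ s ∈ V s

namespace IsRegular

variable {V : ℝ → Submodule ℝ H} {ξ ξ' : ℝ → H}

theorem zero : IsRegular V (fun _ => 0) where
  bounded := ⟨0, by simp⟩
  ae_continuousAt := Eventually.of_forall fun _ => continuousAt_const
  adapted _ := zero_mem _

theorem indicator (h : IsRegular V ξ) {S : Set ℝ} (hS : volume (frontier S) = 0) :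
    IsRegular V (S.indicator ξ) where
  toIsRiemann := h.toIsRiemann.indicator hS
  adapted s := by
    by_cases hs : s ∈ S
    · rw [indicator_of_mem hs]; exact h.adapted s
    · rw [indicator_of_notMem hs]; exact zero_mem _

theorem indicator_Iio (h : IsRegular V ξ) (u : ℝ) : IsRegular V ((Iio u).indicator ξ) :=
  h.indicator (by simp)

theorem indicator_Ico (h : IsRegular V ξ) (a b : ℝ) : IsRegular V ((Ico a b).indicator ξ) := by
  refine h.indicator ?_
  rcases lt_or_ge a b with hab | hab
  · rw [frontier_Ico hab]; exact (Set.toFinite _).measure_zero _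
  · rw [Ico_eq_empty (not_lt.2 hab)]; simp

theorem smul {ρ : ℝ → ℝ} (hρ : IsRiemann ρ) (h : IsRegular V ξ) :
    IsRegular V (fun s => ρ s • ξ s) where
  toIsRiemann := hρ.smul h.toIsRiemann
  adapted s := Submodule.smul_mem _ _ (h.adapted s)

theorem add (h : IsRegular V ξ) (h' : IsRegular V ξ') : IsRegular V (fun s => ξ s + ξ' s) where
  bounded := by
    obtain ⟨M, hM⟩ := h.bounded
    obtain ⟨R, hR⟩ := h'.bounded
    exact ⟨M + R, fun s => norm_add_le_of_le (hM s) (hR s)⟩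
  ae_continuousAt := by
    filter_upwards [h.ae_continuousAt, h'.ae_continuousAt] with s h1 h2
    exact h1.add h2
  adapted s := add_mem (h.adapted s) (h'.adapted s)

theorem neg (h : IsRegular V ξ) : IsRegular V (fun s => - ξ s) where
  bounded := by
    obtain ⟨M, hM⟩ := h.bounded
    exact ⟨M, fun s => by simpa using hM s⟩
  ae_continuousAt := h.ae_continuousAt.mono fun _ h1 => h1.neg
  adapted s := neg_mem (h.adapted s)

theorem sub (h : IsRegular V ξ) (h' : IsRegular V ξ') : IsRegular V (fun s => ξ s - ξ' s) := by
  simpa only [sub_eq_add_neg] using h.add h'.neg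

theorem sum {ι : Type*} (S : Finset ι) {F : ι → ℝ → H} (h : ∀ i ∈ S, IsRegular V (F i)) :
    IsRegular V (fun s => ∑ i ∈ S, F i s) := by
  classical
  induction S using Finset.induction_on with
  | empty => simpa using zero
  | insert i S hi ih =>
    simp only [Finset.sum_insert hi]
    exact (h i (Finset.mem_insert_self i S)).add
      (ih fun j hj => h j (Finset.mem_insert_of_mem hj))

/-- The process that jumps from `0` to `x` at time `c`. -/
theorem indicator_Ici_const (hV : Monotone V) {c : ℝ} {x : H} (hx : x ∈ V c) :
    IsRegular V ((Ici c).indicator fun _ => x) where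
  toIsRiemann := IsRiemann.indicator ⟨⟨‖x‖, fun _ => le_rfl⟩,
    Eventually.of_forall fun _ => continuousAt_const⟩ (by simp)
  adapted s := by
    by_cases hs : s ∈ Ici c
    · rw [indicator_of_mem hs]; exact hV hs hx
    · rw [indicator_of_notMem hs]; exact zero_mem _

end IsRegular

variable {V : ℝ → Submodule ℝ H} {D : ℝ → ℝ → H → H} {T : ℝ} {K : ℝ≥0} {ξ ξ' : ℝ → H}

theorem sum_mem_stepGraph {a b : ℝ} {τ : ℕ → ℕ → ℝ} (hτ : IsPartitionSeq a b τ) (ha : 0 ≤ a)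
    (hb : b ≤ T) {N : ℕ} (hN : 1 ≤ N) {x : ℕ → H} (hx : ∀ j < N, x j ∈ V (τ N j)) :
    ((fun s => ∑ j ∈ Finset.range N, (Ico (τ N j) (τ N (j + 1))).indicator (fun _ => x j) s),
      ∑ j ∈ Finset.range N, D (τ N j) (τ N (j + 1)) (x j)) ∈ stepGraph V D T := by
  have : ((fun s => ∑ j ∈ Finset.range N, (Ico (τ N j) (τ N (j + 1))).indicator (fun _ => x j) s),
      ∑ j ∈ Finset.range N, D (τ N j) (τ N (j + 1)) (x j)) =
      ∑ j ∈ Finset.range N, ((Ico (τ N j) (τ N (j + 1))).indicator (fun _ => x j),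
        D (τ N j) (τ N (j + 1)) (x j)) := by
    ext s
    · simp [Prod.fst_sum, Finset.sum_apply]
    · simp [Prod.snd_sum]
  rw [this]
  refine sum_mem fun j hj => ?_
  have hj := Finset.mem_range.1 hj
  exact mem_stepGraph (ha.trans (hτ.mem_Icc hN hj.le).1) (hτ.mono N hN j hj)
    ((hτ.mem_Icc hN (j := j + 1) hj).2.trans hb) (hx j hj)

theorem Ico_ae_eq_restrict : ∀ᵐ s ∂timeMeasure T, s ∈ Ico 0 T := by
  have h1 : ∀ᵐ s ∂timeMeasure T, s ∈ Icc 0 T := ae_restrict_mem measurableSet_Icc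
  have h2 : ∀ᵐ s ∂timeMeasure T, s ≠ T := ae_restrict_of_ae (Measure.ae_ne volume T)
  filter_upwards [h1, h2] with s hs hs'
  exact ⟨hs.1, lt_of_le_of_ne hs.2 hs'⟩

-- Almost everywhere continuity exhibits ξ as an a.e. limit of left-point step functions. This gives
-- strong measurability without separability of H.
omit [NormedSpace ℝ H] in
theorem IsRiemann.aestronglyMeasurable (h : IsRiemann ξ) :
    AEStronglyMeasurable ξ (timeMeasure T) := by
  rcases lt_or_ge T 0 with hT | hT
  · rw [timeMeasure, Icc_eq_empty (not_le.2 hT), Measure.restrict_empty]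
    exact aestronglyMeasurable_zero_measure _
  have hτ := IsPartitionSeq.uniform hT
  refine aestronglyMeasurable_of_tendsto_ae atTop
    (fun N : ℕ => (stronglyMeasurable_leftStep (fun j => 0 + (T - 0) * ((j : ℝ) / (N : ℝ)))
      (fun j => if 0 + (T - 0) * (((j + 1 : ℕ) : ℝ) / (N : ℝ)) ≤ T + 1 then
        ξ (0 + (T - 0) * ((j : ℝ) / (N : ℝ))) else 0) N).aestronglyMeasurable) ?_
  filter_upwards [Ico_ae_eq_restrict, ae_restrict_of_ae h.ae_continuousAt] with s hs hc
  have := tendsto_leftStep hτ hc (T + 1) (by linarith [hs.2])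
  rwa [indicator_of_mem (show s ∈ Iio (T + 1) by simp only [mem_Iio]; linarith [hs.2]),
    indicator_of_mem hs] at this

/-- Pointwise convergence holds except at u and at discontinuities of ξ, and all functions share the
bound of ξ. Only intervals completed by time u are kept: this is the form in which the partial sums
appear when the order of integration is exchanged. -/
theorem tendsto_eLpNorm_leftStep {a b : ℝ} {τ : ℕ → ℕ → ℝ} (hτ : IsPartitionSeq a b τ)
    (h : IsRegular V ξ) (u : ℝ) :
    Tendsto (fun N => eLpNorm ((fun s => ∑ j ∈ Finset.range N,
      (Ico (τ N j) (τ N (j + 1))).indicator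
        (fun _ => if τ N (j + 1) ≤ u then ξ (τ N j) else 0) s) -
        (Iio u).indicator ((Ico a b).indicator ξ)) 2 (timeMeasure T)) atTop (𝓝 0) := by
  obtain ⟨M, hM⟩ := h.bounded
  have hM0 : 0 ≤ M := (norm_nonneg _).trans (hM 0)
  have hreg := (h.indicator_Ico a b).indicator_Iio u
  refine tendsto_eLpNorm_two_zero_of_bounded (M := M + M) (Eventually.of_forall fun N =>
    (stronglyMeasurable_leftStep _ _ N).aestronglyMeasurable.sub hreg.aestronglyMeasurable) ?_ ?_
  · filter_upwards [eventually_ge_atTop 1] with N hN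
    refine Eventually.of_forall fun s => norm_sub_le_of_le ?_ ?_
    · refine norm_sum_indicator_Ico_le (hτ.mono N hN) s (fun i _ => ?_) hM0
      split_ifs
      · exact hM _
      · simpa using hM0
    · exact (norm_indicator_le_norm_self _ _).trans
        ((norm_indicator_le_norm_self _ _).trans (hM s))
  · filter_upwards [ae_restrict_of_ae h.ae_continuousAt,
      ae_restrict_of_ae (Measure.ae_ne volume u)] with s hc hs
    have := (tendsto_leftStep hτ hc u hs).sub_const
      ((Iio u).indicator ((Ico a b).indicator ξ) s)
    simpa only [sub_self, Pi.sub_apply] using this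

variable [CompleteSpace H]

theorem isIto_stopped (hD : IsL2Integrator V D T K) {a b : ℝ} (hab : a ≤ b) (ha : 0 ≤ a)
    (hb : b ≤ T) (h : IsRegular V ξ) (u : ℝ) :
    IsIto V D T ((Iio u).indicator ((Ico a b).indicator ξ))
      (ito V D T ((Iio u).indicator ((Ico a b).indicator ξ))) := by
  have hτ := IsPartitionSeq.uniform hab
  obtain ⟨X, hX⟩ := IsIto.exists_of_tendsto hD
    ((h.indicator_Ico a b).indicator_Iio u).aestronglyMeasurable
    (p := fun N => (_, ∑ j ∈ Finset.range N, D _ _ _)) (by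
      filter_upwards [eventually_ge_atTop 1] with N hN
      refine sum_mem_stepGraph hτ ha hb hN (x := fun j => if a + (b - a) *
        (((j + 1 : ℕ) : ℝ) / (N : ℝ)) ≤ u then ξ (a + (b - a) * ((j : ℝ) / (N : ℝ))) else 0)
        fun j hj => ?_
      split_ifs
      · exact h.adapted _
      · exact zero_mem _) (tendsto_eLpNorm_leftStep hτ h u)
  rwa [hX.ito_eq hD]

theorem isIto_of_isRegular (hD : IsL2Integrator V D T K) (h : IsRegular V ξ) :
    IsIto V D T ξ (ito V D T ξ) := by
  -- Stopping at T + 1 is no stopping at all on [0, T].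
  have h1 := isIto_stopped hD hD.nonneg le_rfl le_rfl h (T + 1)
  have h2 : IsIto V D T ξ (ito V D T ((Iio (T + 1)).indicator ((Ico 0 T).indicator ξ))) := by
    refine h1.congr ?_
    filter_upwards [Ico_ae_eq_restrict] with s hs
    rw [indicator_of_mem (show s ∈ Iio (T + 1) by simp only [mem_Iio]; linarith [hs.2]),
      indicator_of_mem hs]
  rwa [h2.ito_eq hD]

theorem ito_add (hD : IsL2Integrator V D T K) (h : IsRegular V ξ) (h' : IsRegular V ξ') :
    ito V D T (fun s => ξ s + ξ' s) = ito V D T ξ + ito V D T ξ' :=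
  ((isIto_of_isRegular hD h).add (isIto_of_isRegular hD h')).ito_eq hD

theorem ito_congr_ae (hD : IsL2Integrator V D T K) (h : IsRegular V ξ)
    (hξ : ξ =ᵐ[timeMeasure T] ξ') : ito V D T ξ' = ito V D T ξ :=
  ((isIto_of_isRegular hD h).congr hξ).ito_eq hD

/-- Convergence of left-point sums stopped at time `u`. -/
theorem tendsto_leftSum_stopped (hD : IsL2Integrator V D T K) (h : IsRegular V ξ) {a b : ℝ}
    {τ : ℕ → ℕ → ℝ} (hτ : IsPartitionSeq a b τ) (ha : 0 ≤ a) (hb : b ≤ T) (u : ℝ) :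
    Tendsto (fun N => ∑ j ∈ Finset.range N, D (τ N j) (τ N (j + 1))
      (if τ N (j + 1) ≤ u then ξ (τ N j) else 0)) atTop
      (𝓝 (ito V D T ((Iio u).indicator ((Ico a b).indicator ξ)))) := by
  refine (isIto_stopped hD hτ.le ha hb h u).tendsto hD ?_ (tendsto_eLpNorm_leftStep hτ h u)
  filter_upwards [eventually_ge_atTop 1] with N hN
  refine IsIto.of_mem (sum_mem_stepGraph hτ ha hb hN fun j hj => ?_)
  split_ifs
  · exact h.adapted _
  · exact zero_mem _

theorem tendsto_leftSum (hD : IsL2Integrator V D T K) (h : IsRegular V ξ) {a b : ℝ}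
    {τ : ℕ → ℕ → ℝ} (hτ : IsPartitionSeq a b τ) (ha : 0 ≤ a) (hb : b ≤ T) :
    Tendsto (fun N => ∑ j ∈ Finset.range N, D (τ N j) (τ N (j + 1)) (ξ (τ N j))) atTop
      (𝓝 (ito V D T ((Ico a b).indicator ξ))) := by
  have h1 := tendsto_leftSum_stopped hD h hτ ha hb b
  rw [indicator_eq_self.2] at h1
  · refine h1.congr' ?_
    filter_upwards [eventually_ge_atTop 1] with N hN
    refine Finset.sum_congr rfl fun j hj => ?_
    rw [if_pos (hτ.mem_Icc hN (Finset.mem_range.1 hj)).2]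
  · intro s hs
    by_contra hs'
    exact hs (indicator_of_notMem (fun hs'' => hs' hs''.2) _)

/-- The indefinite integral. -/
noncomputable def primitive (V : ℝ → Submodule ℝ H) (D : ℝ → ℝ → H → H) (T : ℝ) (ξ : ℝ → H)
    (u : ℝ) : H :=
  ito V D T ((Iio u).indicator ξ)

theorem primitive_isIto (hD : IsL2Integrator V D T K) (h : IsRegular V ξ) (u : ℝ) :
    IsIto V D T ((Iio u).indicator ξ) (primitive V D T ξ u) :=
  isIto_of_isRegular hD (h.indicator_Iio u)

theorem primitive_add (hD : IsL2Integrator V D T K) (h : IsRegular V ξ) (h' : IsRegular V ξ')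
    (u : ℝ) : primitive V D T (fun s => ξ s + ξ' s) u =
      primitive V D T ξ u + primitive V D T ξ' u := by
  have := ((primitive_isIto hD h u).add (primitive_isIto hD h' u)).ito_eq hD
  rw [← this, primitive]
  congr 1
  ext s
  simp only [indicator_apply, Pi.add_apply]
  split_ifs <;> simp

theorem enorm_primitive_le (hD : IsL2Integrator V D T K) (h : IsRegular V ξ) (u : ℝ) :
    ‖primitive V D T ξ u‖ₑ ≤ K * eLpNorm ξ 2 (timeMeasure T) :=
  ((primitive_isIto hD h u).enorm_le hD).trans (by gcongr; exact eLpNorm_indicator_le _)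

/-- The integral up to u is a limit of left-point sums whose nodes all lie in [0, min u T]. Each
such sum belongs to V u, which is closed. -/
theorem primitive_mem (hD : IsL2Integrator V D T K) (h : IsRegular V ξ) (u : ℝ) :
    primitive V D T ξ u ∈ V u := by
  rcases lt_or_ge u 0 with hu | hu
  · have : primitive V D T ξ u = 0 := by
      have h0 : IsIto V D T (0 : ℝ → H) 0 := by
        simpa using IsIto.of_mem (zero_mem (stepGraph V D T))
      refine (h0.congr ?_).ito_eq hD
      filter_upwards [Ico_ae_eq_restrict] with s hs
      rw [indicator_of_notMem]
      · rfl
      · exact fun hs' => absurd hs.1 (not_le.2 ((mem_Iio.1 hs').trans hu))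
    rw [this]; exact zero_mem _
  · have hb : 0 ≤ min u T := le_min hu hD.nonneg
    have hτ := IsPartitionSeq.uniform hb
    have h1 := tendsto_leftSum hD h hτ le_rfl (min_le_right u T)
    have h2 : ito V D T ((Ico 0 (min u T)).indicator ξ) = primitive V D T ξ u := by
      refine ito_congr_ae hD (h.indicator_Iio u) ?_
      filter_upwards [Ico_ae_eq_restrict] with s hs
      simp only [indicator_apply, mem_Iio, mem_Ico, lt_min_iff, hs.1, hs.2, true_and, and_true]
    rw [h2] at h1
    refine (hD.closed u).mem_of_tendsto h1 ?_
    filter_upwards [eventually_ge_atTop 1] with N hN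
    refine sum_mem fun j hj => ?_
    have hj := Finset.mem_range.1 hj
    have h3 := hτ.mem_Icc hN (j := j + 1) hj
    exact hD.mono (h3.2.trans (min_le_left _ _)) (hD.mem _ _ _ (hτ.mem_Icc hN hj.le).1
      (hτ.mono N hN j hj) (h3.2.trans (min_le_right _ _)) (h.adapted _))

/-- The indefinite integral is Hölder continuous of order `1 / 2` in norm. -/
theorem exists_holder_primitive (hD : IsL2Integrator V D T K) (h : IsRegular V ξ) :
    ∃ C : ℝ, 0 ≤ C ∧ ∀ u v, ‖primitive V D T ξ u - primitive V D T ξ v‖ ≤ C * √|u - v| := by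
  obtain ⟨M, hM⟩ := h.bounded
  have hM0 : 0 ≤ M := (norm_nonneg _).trans (hM 0)
  refine ⟨K * M, by positivity, ?_⟩
  have key : ∀ u v, v ≤ u →
      ‖primitive V D T ξ u - primitive V D T ξ v‖ ≤ K * M * √|u - v| := by
    intro u v huv
    -- The difference is the integral of ξ over [v, u). Its integrand is bounded by M on a set of
    -- measure at most u − v, hence the square root.
    have h1 := ((primitive_isIto hD h u).sub (primitive_isIto hD h v)).enorm_le hD
    have h2 : (Iio u).indicator ξ - (Iio v).indicator ξ = (Ico v u).indicator ξ := by
      ext s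
      simp only [Pi.sub_apply, indicator_apply, mem_Iio, mem_Ico]
      by_cases h3 : s < v
      · simp [h3, h3.trans_le huv, not_le.2 h3]
      · simp [h3, not_lt.1 h3]
    rw [h2, eLpNorm_indicator_eq_eLpNorm_restrict measurableSet_Ico] at h1
    have h3 := eLpNorm_le_of_ae_bound (p := 2) (μ := (timeMeasure T).restrict (Ico v u))
      (f := ξ) (C := M) (Eventually.of_forall hM)
    have h4 : ((timeMeasure T).restrict (Ico v u)) univ ≤ ENNReal.ofReal (u - v) := by
      rw [Measure.restrict_apply_univ]
      exact (Measure.restrict_apply_le _ _).trans (by rw [Real.volume_Ico])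
    have h5 : ‖primitive V D T ξ u - primitive V D T ξ v‖ₑ ≤
        ENNReal.ofReal (K * M * √|u - v|) := by
      refine h1.trans ?_
      rw [mul_assoc, ENNReal.ofReal_mul (by positivity), mul_comm M,
        ENNReal.ofReal_mul (by positivity), ENNReal.ofReal_coe_nnreal]
      gcongr
      refine h3.trans ?_
      gcongr
      have h6 : |u - v| = u - v := abs_of_nonneg (by linarith)
      rw [h6, Real.sqrt_eq_rpow, ← ENNReal.ofReal_rpow_of_nonneg (by linarith) (by norm_num)]
      simp only [ENNReal.toReal_ofNat, one_div]
      gcongr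
    rw [← ofReal_norm] at h5
    exact (ENNReal.ofReal_le_ofReal_iff (by positivity)).1 h5
  intro u v
  rcases le_total v u with huv | huv
  · exact key u v huv
  · rw [norm_sub_rev, abs_sub_comm]; exact key v u huv

theorem continuous_primitive (hD : IsL2Integrator V D T K) (h : IsRegular V ξ) :
    Continuous (primitive V D T ξ) := by
  obtain ⟨C, -, hC⟩ := exists_holder_primitive hD h
  rw [continuous_iff_continuousAt]
  intro v
  rw [ContinuousAt, tendsto_iff_norm_sub_tendsto_zero]
  have : Tendsto (fun u => C * √|u - v|) (𝓝 v) (𝓝 (C * √|v - v|)) :=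
    Continuous.tendsto (f := fun u => C * √|u - v|) (by fun_prop) v
  simp only [sub_self, abs_zero, Real.sqrt_zero, mul_zero] at this
  exact squeeze_zero (fun _ => norm_nonneg _) (fun u => hC u v) this

theorem IsRegular.primitive (hD : IsL2Integrator V D T K) (h : IsRegular V ξ) :
    IsRegular V (primitive V D T ξ) where
  bounded := by
    have hM := h.bounded
    obtain ⟨M, hM⟩ := hM
    have hfin : K * eLpNorm ξ 2 (timeMeasure T) ≠ ∞ := by
      refine ENNReal.mul_ne_top ENNReal.coe_ne_top ?_
      exact (MemLp.of_bound h.aestronglyMeasurable M (Eventually.of_forall hM)).eLpNorm_ne_top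
    refine ⟨(K * eLpNorm ξ 2 (timeMeasure T)).toReal, fun u => ?_⟩
    rw [← toReal_enorm]
    exact ENNReal.toReal_mono hfin (enorm_primitive_le hD h u)
  ae_continuousAt := Eventually.of_forall fun _ => (continuous_primitive hD h).continuousAt
  adapted := primitive_mem hD h

end Regular

/-! ### The Wiener process and time as bounded integrators on L²(P). -/

section Concrete

variable {Ω : Type*} [mΩ : MeasurableSpace Ω]

open Classical in
/-- The class in `L²` of a random variable, `0` if it is not square integrable. -/
noncomputable def toL2 (P : Measure Ω) (X : Ω → ℝ) : Lp ℝ 2 P :=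
  if h : MemLp X 2 P then h.toLp X else 0

theorem coeFn_toL2 {P : Measure Ω} {X : Ω → ℝ} (h : MemLp X 2 P) : toL2 P X =ᵐ[P] X := by
  rw [toL2, dif_pos h]
  exact h.coeFn_toLp

/-- The subspace of square integrable random variables known at time `s`. -/
noncomputable def adaptedL2 (P : Measure Ω) (ℱ : Filtration ℝ mΩ) (s : ℝ) :
    Submodule ℝ (Lp ℝ 2 P) :=
  lpMeas ℝ ℝ (ℱ s) 2 P

/-- Multiplication by the increment of an integrator. -/
noncomputable def mulIncr (P : Measure Ω) (f : ℝ → Ω → ℝ) (w : Integrator) (c d : ℝ)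
    (x : Lp ℝ 2 P) : Lp ℝ 2 P :=
  toL2 P (fun ω => x ω * (w.path f d ω - w.path f c ω))

variable {P : Measure Ω} {ℱ : Filtration ℝ mΩ} {f : ℝ → Ω → ℝ} {T : ℝ}

theorem mem_adaptedL2 {s : ℝ} {x : Lp ℝ 2 P} :
    x ∈ adaptedL2 P ℱ s ↔ AEStronglyMeasurable[ℱ s] x P :=
  mem_lpMeas_iff_aestronglyMeasurable

theorem toL2_mem {s : ℝ} {X : Ω → ℝ} (h : MemLp X 2 P) (hX : AEStronglyMeasurable[ℱ s] X P) :
    toL2 P X ∈ adaptedL2 P ℱ s :=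
  mem_adaptedL2.2 (hX.congr (coeFn_toL2 h).symm)

theorem adaptedL2_mono : Monotone (adaptedL2 P ℱ) := fun _ _ hst _ hx =>
  mem_adaptedL2.2 ((mem_adaptedL2.1 hx).mono (ℱ.mono hst))

theorem isClosed_adaptedL2 (s : ℝ) : IsClosed (adaptedL2 P ℱ s : Set (Lp ℝ 2 P)) := by
  have := isClosed_aestronglyMeasurable (F := ℝ) (p := 2) (μ := P) (ℱ.le s)
  convert this using 1
  ext x
  exact mem_adaptedL2

namespace IsWiener

theorem measurable_incr (hf : IsWiener P ℱ T f) {c d : ℝ} (hc : 0 ≤ c) (hcd : c ≤ d)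
    (hd : d ≤ T) : Measurable[ℱ d] (fun ω => f d ω - f c ω) :=
  (hf.adapted d ⟨hc.trans hcd, hd⟩).sub
    ((hf.adapted c ⟨hc, hcd.trans hd⟩).mono (ℱ.mono hcd) le_rfl)

theorem hasLaw_incr (hf : IsWiener P ℱ T f) {c d : ℝ} (hc : 0 ≤ c) (hcd : c ≤ d)
    (hd : d ≤ T) : HasLaw (fun ω => f d ω - f c ω) (gaussianReal 0 (d - c).toNNReal) P :=
  ⟨((hf.measurable_incr hc hcd hd).mono (ℱ.le d) le_rfl).aemeasurable, hf.gaussian c d hc hcd hd⟩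

theorem memLp_incr (hf : IsWiener P ℱ T f) {c d : ℝ} (hc : 0 ≤ c) (hcd : c ≤ d)
    (hd : d ≤ T) : MemLp (fun ω => f d ω - f c ω) 2 P := by
  have h1 : MemLp id 2 (P.map (fun ω => f d ω - f c ω)) := by
    rw [hf.gaussian c d hc hcd hd]
    exact memLp_id_gaussianReal 2
  exact h1.comp_of_map (hf.hasLaw_incr hc hcd hd).aemeasurable

theorem integral_incr (hf : IsWiener P ℱ T f) {c d : ℝ} (hc : 0 ≤ c) (hcd : c ≤ d)
    (hd : d ≤ T) : ∫ ω, (f d ω - f c ω) ∂P = 0 := by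
  have := (hf.hasLaw_incr hc hcd hd).integral_eq
  rw [integral_id_gaussianReal] at this
  exact this

theorem integral_incr_sq (hf : IsWiener P ℱ T f) {c d : ℝ} (hc : 0 ≤ c) (hcd : c ≤ d)
    (hd : d ≤ T) : ∫ ω, (f d ω - f c ω) ^ 2 ∂P = d - c := by
  have := (hf.hasLaw_incr hc hcd hd).variance_eq
  rw [variance_id_gaussianReal, variance_of_integral_eq_zero
    (hf.hasLaw_incr hc hcd hd).aemeasurable (hf.integral_incr hc hcd hd)] at this
  rw [Real.coe_toNNReal _ (by linarith)] at this
  exact this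

/-- Increments are independent of random variables known before. -/
theorem indepFun_incr (hf : IsWiener P ℱ T f) {c d : ℝ} (hc : 0 ≤ c) (hcd : c ≤ d)
    (hd : d ≤ T) {X : Ω → ℝ} (hX : AEStronglyMeasurable[ℱ c] X P) :
    IndepFun X (fun ω => f d ω - f c ω) P := by
  have h1 : IndepFun (hX.mk X) (fun ω => f d ω - f c ω) P := by
    rw [IndepFun_iff_Indep]
    exact indep_of_indep_of_le_left (hf.indep c d hc hcd hd).symm
      hX.stronglyMeasurable_mk.measurable.comap_le
  exact h1.congr hX.ae_eq_mk.symm (EventuallyEq.refl _ _)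

/-- The squares of X and of the increment are independent and integrable, so their product is
integrable. No higher moments of X are needed. -/
theorem memLp_mul_incr (hf : IsWiener P ℱ T f) {c d : ℝ} (hc : 0 ≤ c) (hcd : c ≤ d)
    (hd : d ≤ T) {X : Ω → ℝ} (hX : AEStronglyMeasurable[ℱ c] X P) (hX2 : MemLp X 2 P) :
    MemLp (fun ω => X ω * (f d ω - f c ω)) 2 P := by
  have hm : AEStronglyMeasurable (fun ω => X ω * (f d ω - f c ω)) P :=
    hX2.1.mul (hf.memLp_incr hc hcd hd).1
  rw [memLp_two_iff_integrable_sq hm]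
  have h1 : IndepFun (fun ω => X ω ^ 2) (fun ω => (f d ω - f c ω) ^ 2) P :=
    (hf.indepFun_incr hc hcd hd hX).comp (measurable_id.pow_const 2) (measurable_id.pow_const 2)
  have h2 := h1.integrable_mul hX2.integrable_sq (hf.memLp_incr hc hcd hd).integrable_sq
  refine h2.congr (Eventually.of_forall fun ω => ?_)
  simp only [Pi.mul_apply]; ring

theorem integral_mul_incr (hf : IsWiener P ℱ T f) {c d : ℝ} (hc : 0 ≤ c) (hcd : c ≤ d)
    (hd : d ≤ T) {X : Ω → ℝ} (hX : AEStronglyMeasurable[ℱ c] X P) :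
    ∫ ω, X ω * (f d ω - f c ω) ∂P = 0 := by
  rw [(hf.indepFun_incr hc hcd hd hX).integral_fun_mul_eq_mul_integral
    (hX.mono (ℱ.le c)) (hf.memLp_incr hc hcd hd).1, hf.integral_incr hc hcd hd, mul_zero]

theorem integral_mul_incr_sq (hf : IsWiener P ℱ T f) {c d : ℝ} (hc : 0 ≤ c) (hcd : c ≤ d)
    (hd : d ≤ T) {X : Ω → ℝ} (hX : AEStronglyMeasurable[ℱ c] X P) :
    ∫ ω, X ω * (f d ω - f c ω) ^ 2 ∂P = (d - c) * ∫ ω, X ω ∂P := by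
  have h1 : IndepFun X (fun ω => (f d ω - f c ω) ^ 2) P :=
    (hf.indepFun_incr hc hcd hd hX).comp measurable_id (measurable_id.pow_const 2)
  rw [h1.integral_fun_mul_eq_mul_integral
    (hX.mono (ℱ.le c)) (hf.memLp_incr hc hcd hd).integrable_sq.1, hf.integral_incr_sq hc hcd hd,
    mul_comm]

end IsWiener

theorem coeFn_mulIncr [IsProbabilityMeasure P] (hf : IsWiener P ℱ T f) (w : Integrator)
    {c d : ℝ} (hc : 0 ≤ c) (hcd : c ≤ d) (hd : d ≤ T) {x : Lp ℝ 2 P} (hx : x ∈ adaptedL2 P ℱ c) :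
    MemLp (fun ω => x ω * (w.path f d ω - w.path f c ω)) 2 P ∧
    mulIncr P f w c d x =ᵐ[P] fun ω => x ω * (w.path f d ω - w.path f c ω) := by
  have key : MemLp (fun ω => x ω * (w.path f d ω - w.path f c ω)) 2 P := by
    cases w with
    | wiener => exact hf.memLp_mul_incr hc hcd hd (mem_adaptedL2.1 hx) (Lp.memLp x)
    | time => exact (Lp.memLp x).mul_const (d - c)
  exact ⟨key, coeFn_toL2 key⟩

theorem mulIncr_mem [IsProbabilityMeasure P] (hf : IsWiener P ℱ T f) (w : Integrator)
    {c d : ℝ} (hc : 0 ≤ c) (hcd : c ≤ d) (hd : d ≤ T) {x : Lp ℝ 2 P} (hx : x ∈ adaptedL2 P ℱ c) :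
    mulIncr P f w c d x ∈ adaptedL2 P ℱ d := by
  rw [mem_adaptedL2]
  refine AEStronglyMeasurable.congr ?_ (coeFn_mulIncr hf w hc hcd hd hx).2.symm
  refine ((mem_adaptedL2.1 hx).mono (ℱ.mono hcd)).mul ?_
  cases w with
  | wiener => exact (hf.measurable_incr hc hcd hd).stronglyMeasurable.aestronglyMeasurable
  | time =>
    change AEStronglyMeasurable[ℱ d] (fun _ => d - c) P
    exact aestronglyMeasurable_const

section WienerIsometry

variable [IsProbabilityMeasure P]

theorem mulIncr_add (hf : IsWiener P ℱ T f) (w : Integrator) {c d e : ℝ} (hc : 0 ≤ c)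
    (hcd : c ≤ d) (hde : d ≤ e) (he : e ≤ T) {x : Lp ℝ 2 P} (hx : x ∈ adaptedL2 P ℱ c) :
    mulIncr P f w c e x = mulIncr P f w c d x + mulIncr P f w d e x := by
  refine Lp.ext ?_
  filter_upwards [(coeFn_mulIncr hf w hc (hcd.trans hde) he hx).2,
    (coeFn_mulIncr hf w hc hcd (hde.trans he) hx).2,
    (coeFn_mulIncr hf w (hc.trans hcd) hde he (adaptedL2_mono hcd hx)).2,
    Lp.coeFn_add (mulIncr P f w c d x) (mulIncr P f w d e x)] with ω h1 h2 h3 h4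
  rw [h4, h1, Pi.add_apply, h2, h3]
  ring

theorem inner_mulIncr_same (hf : IsWiener P ℱ T f) {c d : ℝ} (hc : 0 ≤ c)
    (hcd : c ≤ d) (hd : d ≤ T) {x y : Lp ℝ 2 P} (hx : x ∈ adaptedL2 P ℱ c)
    (hy : y ∈ adaptedL2 P ℱ c) :
    inner ℝ (mulIncr P f .wiener c d x) (mulIncr P f .wiener c d y) = (d - c) * inner ℝ x y := by
  rw [L2.inner_def, L2.inner_def]
  have := hf.integral_mul_incr_sq hc hcd hd
    (X := fun ω => y ω * x ω) ((mem_adaptedL2.1 hy).mul (mem_adaptedL2.1 hx))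
  simp only [RCLike.inner_apply, conj_trivial]
  rw [← this]
  refine integral_congr_ae ?_
  filter_upwards [(coeFn_mulIncr hf .wiener hc hcd hd hx).2,
    (coeFn_mulIncr hf .wiener hc hcd hd hy).2] with ω h1 h2
  rw [h1, h2]
  simp only [Integrator.path]
  ring

theorem inner_mulIncr_adapted (hf : IsWiener P ℱ T f) {c d : ℝ} (hc : 0 ≤ c)
    (hcd : c ≤ d) (hd : d ≤ T) {x y : Lp ℝ 2 P} (hx : x ∈ adaptedL2 P ℱ c)
    (hy : y ∈ adaptedL2 P ℱ c) :
    inner ℝ x (mulIncr P f .wiener c d y) = 0 := by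
  rw [L2.inner_def]
  have := hf.integral_mul_incr hc hcd hd
    (X := fun ω => y ω * x ω) ((mem_adaptedL2.1 hy).mul (mem_adaptedL2.1 hx))
  simp only [RCLike.inner_apply, conj_trivial]
  rw [← this]
  refine integral_congr_ae ?_
  filter_upwards [(coeFn_mulIncr hf .wiener hc hcd hd hy).2] with ω h2
  rw [h2]
  simp only [Integrator.path]
  ring

theorem inner_mulIncr_same_left (hf : IsWiener P ℱ T f) {c d d' : ℝ} (hc : 0 ≤ c)
    (hcd : c ≤ d) (hdd : d ≤ d') (hd : d' ≤ T) {x y : Lp ℝ 2 P} (hx : x ∈ adaptedL2 P ℱ c)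
    (hy : y ∈ adaptedL2 P ℱ c) :
    inner ℝ (mulIncr P f .wiener c d x) (mulIncr P f .wiener c d' y) = (d - c) * inner ℝ x y := by
  rw [mulIncr_add hf .wiener hc hcd hdd hd hy, inner_add_right,
    inner_mulIncr_same hf hc hcd (hdd.trans hd) hx hy,
    inner_mulIncr_adapted hf (hc.trans hcd) hdd hd
      (mulIncr_mem hf .wiener hc hcd (hdd.trans hd) hx) (adaptedL2_mono hcd hy), add_zero]

theorem inner_mulIncr (hf : IsWiener P ℱ T f) {c d c' d' : ℝ} (hc : 0 ≤ c) (hcd : c ≤ d)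
    (hd : d ≤ T) (hc' : 0 ≤ c') (hcd' : c' ≤ d') (hd' : d' ≤ T) {x y : Lp ℝ 2 P}
    (hx : x ∈ adaptedL2 P ℱ c) (hy : y ∈ adaptedL2 P ℱ c') :
    inner ℝ (mulIncr P f .wiener c d x) (mulIncr P f .wiener c' d' y) =
      max 0 (min d d' - max c c') * inner ℝ x y := by
  -- By symmetry, take c ≤ c'. The part of the first increment before c' is known at c', hence
  -- orthogonal to the second increment. What remains starts at the common time c', and only the
  -- overlap contributes.
  have key : ∀ {c d c' d' : ℝ}, 0 ≤ c → c ≤ d → d ≤ T → c' ≤ d' → d' ≤ T →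
      ∀ {x y : Lp ℝ 2 P}, x ∈ adaptedL2 P ℱ c → y ∈ adaptedL2 P ℱ c' → c ≤ c' →
      inner ℝ (mulIncr P f .wiener c d x) (mulIncr P f .wiener c' d' y) =
        max 0 (min d d' - max c c') * inner ℝ x y := by
    clear * - hf
    intro c d c' d' hc hcd hd hcd' hd' x y hx hy hcc
    rcases le_total d c' with h | h
    · rw [inner_mulIncr_adapted hf (hc.trans hcc) hcd' hd'
        (adaptedL2_mono h (mulIncr_mem hf .wiener hc hcd hd hx)) hy, max_eq_left, zero_mul]
      have h1 := min_le_left d d'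
      have h2 := le_max_right c c'
      linarith
    · rw [mulIncr_add hf .wiener hc hcc h hd hx, inner_add_left,
        inner_mulIncr_adapted hf (hc.trans hcc) hcd' hd'
          (mulIncr_mem hf .wiener hc hcc (h.trans hd) hx) hy, zero_add, max_eq_right hcc]
      have hx' := adaptedL2_mono hcc hx
      rcases le_total d d' with hdd | hdd
      · rw [inner_mulIncr_same_left hf (hc.trans hcc) h hdd hd' hx' hy, min_eq_left hdd,
          max_eq_right (by linarith)]
      · rw [real_inner_comm, inner_mulIncr_same_left hf (hc.trans hcc) hcd' hdd hd hy hx',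
          min_eq_right hdd, max_eq_right (by linarith), real_inner_comm]
  rcases le_total c c' with h | h
  · exact key hc hcd hd hcd' hd' hx hy h
  · rw [real_inner_comm, key hc' hcd' hd' hcd hd hy hx h, real_inner_comm, min_comm, max_comm c c']

theorem integral_inner_indicator {H : Type*} [NormedAddCommGroup H] [InnerProductSpace ℝ H]
    {c d c' d' : ℝ} (hc : 0 ≤ c) (hd : d ≤ T) (x y : H) :
    ∫ s, inner ℝ ((Ico c d).indicator (fun _ => x) s) ((Ico c' d').indicator (fun _ => y) s)
      ∂timeMeasure T = max 0 (min d d' - max c c') * inner ℝ x y := by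
  have h1 : ∀ s, inner ℝ ((Ico c d).indicator (fun _ => x) s)
      ((Ico c' d').indicator (fun _ => y) s) =
      (Ico (max c c') (min d d')).indicator (fun _ => inner ℝ x y) s := by
    intro s
    rw [← Ico_inter_Ico]
    by_cases h : s ∈ Ico c d <;> by_cases h' : s ∈ Ico c' d' <;> simp [h, h']
  simp_rw [h1]
  rw [integral_indicator measurableSet_Ico, setIntegral_const, smul_eq_mul]
  congr 1
  rw [measureReal_restrict_apply measurableSet_Ico, inter_eq_left.2, Real.volume_real_Ico,
    max_comm]
  exact fun s hs => ⟨hc.trans ((le_max_left _ _).trans hs.1),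
    (hs.2.le.trans (min_le_left _ _)).trans hd⟩

/-- The Ito isometry for step processes. -/
theorem inner_stepGraph_wiener (hf : IsWiener P ℱ T f) {p q : (ℝ → Lp ℝ 2 P) × Lp ℝ 2 P}
    (hp : p ∈ stepGraph (adaptedL2 P ℱ) (mulIncr P f .wiener) T)
    (hq : q ∈ stepGraph (adaptedL2 P ℱ) (mulIncr P f .wiener) T) :
    inner ℝ p.2 q.2 = ∫ s, inner ℝ (p.1 s) (q.1 s) ∂timeMeasure T := by
  have hint : ∀ {p q : (ℝ → Lp ℝ 2 P) × Lp ℝ 2 P},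
      p ∈ stepGraph (adaptedL2 P ℱ) (mulIncr P f .wiener) T →
      q ∈ stepGraph (adaptedL2 P ℱ) (mulIncr P f .wiener) T →
      Integrable (fun s => (inner ℝ (p.1 s) (q.1 s) : ℝ)) (timeMeasure T) := by
    intro p q hp hq
    have h1 := stepGraph.memLp hp
    have h2 := stepGraph.memLp hq
    refine (h1.norm.integrable_mul h2.norm).mono (h1.1.inner h2.1) ?_
    exact Eventually.of_forall fun s => by
      simpa using abs_real_inner_le_norm (p.1 s) (q.1 s)
  unfold stepGraph at hp hq
  -- Both sides are bilinear, so the identity need only be checked on single-interval generators,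
  -- where each side is the overlap length times the inner product.
  induction hp, hq using Submodule.span_induction₂ with
  | mem_mem p q hp hq =>
    obtain ⟨c, d, x, hc, hcd, hd, hx, rfl⟩ := hp
    obtain ⟨c', d', y, hc', hcd', hd', hy, rfl⟩ := hq
    rw [inner_mulIncr hf hc hcd hd hc' hcd' hd' hx hy, integral_inner_indicator hc hd]
  | zero_left q hq => simp
  | zero_right p hp => simp
  | add_left p p' q hp hp' hq h1 h2 =>
    simp only [Prod.fst_add, Prod.snd_add, Pi.add_apply, inner_add_left]
    rw [integral_add (hint hp hq) (hint hp' hq), h1, h2]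
  | add_right p q q' hp hq hq' h1 h2 =>
    simp only [Prod.fst_add, Prod.snd_add, Pi.add_apply, inner_add_right]
    rw [integral_add (hint hp hq) (hint hp hq'), h1, h2]
  | smul_left r p q hp hq h =>
    simp only [Prod.smul_fst, Prod.smul_snd, Pi.smul_apply, real_inner_smul_left]
    rw [integral_const_mul, h]
  | smul_right r p q hp hq h =>
    simp only [Prod.smul_fst, Prod.smul_snd, Pi.smul_apply, real_inner_smul_right]
    rw [integral_const_mul, h]

omit [IsProbabilityMeasure P] in
theorem snd_eq_integral_of_time {p : (ℝ → Lp ℝ 2 P) × Lp ℝ 2 P}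
    (hp : p ∈ stepGraph (adaptedL2 P ℱ) (mulIncr P f .time) T) :
    p.2 = ∫ s, p.1 s ∂timeMeasure T := by
  have hint : ∀ {p : (ℝ → Lp ℝ 2 P) × Lp ℝ 2 P},
      p ∈ stepGraph (adaptedL2 P ℱ) (mulIncr P f .time) T → Integrable p.1 (timeMeasure T) :=
    fun hp => (stepGraph.memLp hp).integrable (by norm_num)
  unfold stepGraph at hp
  induction hp using Submodule.span_induction with
  | mem p hp =>
    obtain ⟨c, d, x, hc, hcd, hd, hx, rfl⟩ := hp
    simp only
    rw [integral_indicator measurableSet_Ico, setIntegral_const,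
      measureReal_restrict_apply measurableSet_Ico, inter_eq_left.2, Real.volume_real_Ico,
      max_eq_left (by linarith)]
    · refine Lp.ext ?_
      have h1 : MemLp (fun ω => x ω * (d - c)) 2 P := (Lp.memLp x).mul_const (d - c)
      have h2 : mulIncr P f .time c d x =ᵐ[P] fun ω => x ω * (d - c) := coeFn_toL2 h1
      filter_upwards [h2, Lp.coeFn_smul (d - c) x] with ω h3 h4
      rw [h3, h4, Pi.smul_apply, smul_eq_mul, mul_comm]
    · exact fun s hs => ⟨hc.trans hs.1, hs.2.le.trans hd⟩
  | zero => simp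
  | add p q hp hq h1 h2 =>
    simp only [Prod.fst_add, Prod.snd_add, Pi.add_apply]
    rw [integral_add (hint hp) (hint hq), h1, h2]
  | smul r p hp h =>
    simp only [Prod.smul_fst, Prod.smul_snd, Pi.smul_apply]
    rw [integral_smul, h]

/-- For the Wiener process the isometry gives K = 1. For time the elementary integral is a Bochner
integral over [0, T], and Cauchy–Schwarz gives K = √T. -/
theorem exists_isL2Integrator (hT : 0 ≤ T) (hf : IsWiener P ℱ T f) (w : Integrator) :
    ∃ K, IsL2Integrator (adaptedL2 P ℱ) (mulIncr P f w) T K := by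
  have hmem : ∀ c d x, 0 ≤ c → c ≤ d → d ≤ T → x ∈ adaptedL2 P ℱ c →
      mulIncr P f w c d x ∈ adaptedL2 P ℱ d := fun c d x hc hcd hd hx =>
    mulIncr_mem hf w hc hcd hd hx
  cases w with
  | wiener =>
    refine ⟨1, hT, adaptedL2_mono, isClosed_adaptedL2, hmem, fun p hp => ?_⟩
    rw [ENNReal.coe_one, one_mul]
    have h1 := inner_stepGraph_wiener hf hp hp
    have h2 := stepGraph.memLp hp
    have h3 : inner ℝ (h2.toLp p.1) (h2.toLp p.1) =
        ∫ s, inner ℝ (p.1 s) (p.1 s) ∂timeMeasure T := by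
      rw [L2.inner_def]
      refine integral_congr_ae ?_
      filter_upwards [h2.coeFn_toLp] with s hs
      rw [hs]
    rw [← h1, real_inner_self_eq_norm_sq, real_inner_self_eq_norm_sq] at h3
    have h4 : ‖p.2‖ = ‖h2.toLp p.1‖ := by
      rwa [sq_eq_sq₀ (norm_nonneg _) (norm_nonneg _), eq_comm] at h3
    rw [Lp.norm_toLp] at h4
    rw [← ofReal_norm, h4, ENNReal.ofReal_toReal h2.eLpNorm_ne_top]
  | time =>
    refine ⟨(T.toNNReal) ^ (1 / 2 : ℝ), hT, adaptedL2_mono, isClosed_adaptedL2, hmem,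
      fun p hp => ?_⟩
    rw [snd_eq_integral_of_time hp]
    refine (enorm_integral_le_lintegral_enorm _).trans ?_
    rw [← eLpNorm_one_eq_lintegral_enorm]
    refine (eLpNorm_le_eLpNorm_mul_rpow_measure_univ (p := 1) (q := 2) (by norm_num)
      (stepGraph.stronglyMeasurable hp).aestronglyMeasurable).trans ?_
    rw [mul_comm]
    gcongr
    rw [Measure.restrict_apply_univ, Real.volume_Icc, sub_zero,
      ENNReal.coe_rpow_of_nonneg _ (by norm_num), ENNReal.ofReal]
    norm_num

end WienerIsometry

end Concrete

/-! ### Translating stochastic integrals of processes into L² integrals of curves. -/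

section Forward

variable {Ω : Type*} [mΩ : MeasurableSpace Ω] {P : Measure Ω} {ℱ : Filtration ℝ mΩ}
  {f : ℝ → Ω → ℝ} {T : ℝ}

theorem eLpNorm_sub_eq_enorm {x y : Lp ℝ 2 P} {X Y : Ω → ℝ} (hX : X =ᵐ[P] x) (hY : Y =ᵐ[P] y) :
    eLpNorm (fun ω => X ω - Y ω) 2 P = ‖x - y‖ₑ := by
  rw [Lp.enorm_def]
  refine eLpNorm_congr_ae ?_
  filter_upwards [hX, hY, Lp.coeFn_sub x y] with ω h1 h2 h3
  rw [h3, h1, h2, Pi.sub_apply]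

theorem lintegral_enorm_sq_eq {α H : Type*} [MeasurableSpace α] [NormedAddCommGroup H]
    {μ : Measure α} (F : α → H) : ∫⁻ x, ‖F x‖ₑ ^ 2 ∂μ = eLpNorm F 2 μ ^ 2 := by
  rw [eLpNorm_eq_lintegral_rpow_enorm_toReal (by norm_num) (by norm_num),
    ← ENNReal.rpow_natCast, ← ENNReal.rpow_mul]
  simp

/-- Once the sums are known to converge in L², being their mean-square limit is the same as being a
version of the known limit. Existence and uniqueness statements thus reduce to one computation. -/
theorem isMSLim_iff {S : ℕ → Ω → ℝ} {I : Ω → ℝ} {Y : ℕ → Lp ℝ 2 P} {X : Lp ℝ 2 P}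
    (hS : ∀ᶠ N in atTop, S N =ᵐ[P] Y N) (hY : Tendsto Y atTop (𝓝 X)) :
    IsMSLim P S I ↔ I =ᵐ[P] X := by
  constructor
  · rintro ⟨hI, h⟩
    have h1 : Tendsto Y atTop (𝓝 (hI.toLp I)) := by
      rw [tendsto_iff_edist_tendsto_0]
      refine h.congr' ?_
      filter_upwards [hS] with N hN
      rw [eLpNorm_sub_eq_enorm hN hI.coeFn_toLp.symm, edist_eq_enorm_sub]
    rw [tendsto_nhds_unique hY h1]
    exact hI.coeFn_toLp.symm
  · intro hI
    refine ⟨(memLp_congr_ae hI).2 (Lp.memLp X), ?_⟩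
    rw [tendsto_iff_edist_tendsto_0] at hY
    refine hY.congr' ?_
    filter_upwards [hS] with N hN
    rw [eLpNorm_sub_eq_enorm hN hI, edist_eq_enorm_sub]

/-- An adapted process which is Hölder continuous in mean square has a jointly measurable version
that is adapted at every time. -/
theorem exists_measurable_version [IsProbabilityMeasure P] {ξ : ℝ → Lp ℝ 2 P}
    (had : ∀ s, ξ s ∈ adaptedL2 P ℱ s) {C : ℝ} (hC0 : 0 ≤ C)
    (hC : ∀ u v, ‖ξ u - ξ v‖ ≤ C * √|u - v|) :
    ∃ Z : ℝ → Ω → ℝ, (∀ u, Z u =ᵐ[P] ξ u) ∧ (∀ u, Measurable[ℱ u] (Z u)) ∧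
      Measurable (fun p : ℝ × Ω => Z p.1 p.2) := by
  choose g hg hgξ using fun s => mem_adaptedL2.1 (had s)
  -- Times are rounded down to the grid of mesh 4^(-n). Rounding down preserves adaptedness, and
  -- order-1/2 Hölder continuity turns the mesh into the summable error C · 2^(-n).
  set q : ℕ → ℝ → ℝ := fun n u => (⌊4 ^ n * u⌋ : ℝ) / 4 ^ n with hq
  have hq1 : ∀ n u, q n u ≤ u := fun n u => by
    rw [hq]; simp only
    rw [div_le_iff₀ (by positivity), mul_comm]
    exact Int.floor_le _
  have hq2 : ∀ n u, u - q n u ≤ ((1 : ℝ) / 4) ^ n := fun n u => by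
    rw [hq]; simp only
    rw [one_div, inv_pow, sub_le_iff_le_add, ← one_div, ← add_div, le_div_iff₀ (by positivity),
      mul_comm u, add_comm]
    exact (Int.lt_floor_add_one _).le
  -- The limsup is measurable at every ω, whether or not the sequence converges there. Summability
  -- of the errors makes it an almost sure limit at each fixed u.
  refine ⟨fun u ω => limsup (fun n => g (q n u) ω) atTop, fun u => ?_, fun u => ?_, ?_⟩
  · have hm : ∀ n, AEStronglyMeasurable (fun ω => g (q n u) ω - ξ u ω) P := fun n =>
      ((hg (q n u)).mono (ℱ.le _)).aestronglyMeasurable.sub (Lp.aestronglyMeasurable (ξ u))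
    have h1 : ∀ n, ∫⁻ ω, ‖g (q n u) ω - ξ u ω‖ₑ ∂P ≤ ENNReal.ofReal (C * (1 / 2) ^ n) := by
      intro n
      rw [← eLpNorm_one_eq_lintegral_enorm]
      refine (eLpNorm_le_eLpNorm_of_exponent_le (q := 2) (by norm_num)
        (hm n)).trans ?_
      rw [eLpNorm_sub_eq_enorm (hgξ (q n u)).symm (EventuallyEq.refl _ _), ← ofReal_norm]
      refine ENNReal.ofReal_le_ofReal ((hC _ _).trans ?_)
      gcongr
      rw [abs_sub_comm, abs_of_nonneg (by linarith [hq1 n u])]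
      refine Real.sqrt_le_iff.2 ⟨by positivity, (hq2 n u).trans_eq ?_⟩
      rw [← pow_mul, mul_comm, pow_mul]; norm_num
    have h2 : ∫⁻ ω, ∑' n, ‖g (q n u) ω - ξ u ω‖ₑ ∂P ≠ ∞ := by
      rw [lintegral_tsum fun n => (hm n).enorm]
      refine ne_top_of_le_ne_top ?_ (ENNReal.tsum_le_tsum h1)
      have hs : Summable fun n : ℕ => C * (1 / 2 : ℝ) ^ n :=
        (summable_geometric_of_lt_one (by norm_num) (by norm_num)).mul_left C
      rw [← ENNReal.ofReal_tsum_of_nonneg (fun n => by positivity) hs]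
      exact ENNReal.ofReal_ne_top
    have h3 := ae_lt_top' (AEMeasurable.tsum fun n => (hm n).enorm) h2
    filter_upwards [h3] with ω hω
    refine Tendsto.limsup_eq ?_
    have h4 := ENNReal.tendsto_atTop_zero_of_tsum_ne_top hω.ne
    rw [tendsto_iff_edist_tendsto_0]
    simpa only [edist_eq_enorm_sub] using h4
  · exact Measurable.limsup fun n => (hg (q n u)).measurable.mono (ℱ.mono (hq1 n u)) le_rfl
  · refine Measurable.limsup fun n => ?_
    have h1 : Measurable fun p : ℤ × Ω => g ((p.1 : ℝ) / 4 ^ n) p.2 :=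
      measurable_from_prod_countable_right fun k =>
        ((hg ((k : ℝ) / 4 ^ n)).mono (ℱ.le _)).measurable
    have h2 : Measurable fun p : ℝ × Ω => (⌊4 ^ n * p.1⌋, p.2) :=
      (Int.measurable_floor.comp (measurable_fst.const_mul _)).prodMk measurable_snd
    exact h1.comp h2

theorem InM2.of_bound [IsProbabilityMeasure P] (hf : IsWiener P ℱ T f) {a b : ℝ} (ha : 0 ≤ a)
    (hb : b ≤ T) {ξ : ℝ → Ω → ℝ}
    (hm : Measurable (fun p : Icc a b × Ω => ξ p.1 p.2))
    (had : ∀ s ∈ Icc a b, Measurable[ℱ s] (ξ s)) {M : ℝ≥0}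
    (hM : ∀ s ∈ Icc a b, eLpNorm (ξ s) 2 P ≤ M) : InM2 P ℱ f a b ξ where
  measurable := hm
  adapted := had
  indep s hs u v hsu huv hvb := hf.indepFun_incr ((ha.trans hs.1).trans hsu) huv.le (hvb.trans hb)
    ((had s hs).mono (ℱ.mono hsu) le_rfl).stronglyMeasurable.aestronglyMeasurable
  lintegral_lt_top := by
    have : ∫⁻ s in Icc a b, ∫⁻ ω, ‖ξ s ω‖ₑ ^ 2 ∂P ≤ ∫⁻ s in Icc a b, (M : ℝ≥0∞) ^ 2 := by
      refine setLIntegral_mono' measurableSet_Icc fun s hs => ?_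
      rw [lintegral_enorm_sq_eq]
      gcongr
      exact hM s hs
    refine this.trans_lt ?_
    rw [setLIntegral_const, Real.volume_Icc]
    exact ENNReal.mul_lt_top (ENNReal.pow_lt_top ENNReal.coe_lt_top) ENNReal.ofReal_lt_top
  memLp s hs := ⟨((had s hs).mono (ℱ.le s) le_rfl).aestronglyMeasurable,
    (hM s hs).trans_lt ENNReal.coe_lt_top⟩

theorem InM2.mono_right {a b c : ℝ} {ξ : ℝ → Ω → ℝ} (h : InM2 P ℱ f a b ξ)
    (hc : c ≤ b) : InM2 P ℱ f a c ξ where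
  measurable := by
    have h1 : Measurable fun p : Icc a c × Ω =>
        ((⟨p.1, p.1.2.1, p.1.2.2.trans hc⟩ : Icc a b), p.2) :=
      (Measurable.subtype_mk (measurable_subtype_coe.comp measurable_fst)).prodMk measurable_snd
    exact h.measurable.comp h1
  adapted s hs := h.adapted s ⟨hs.1, hs.2.trans hc⟩
  indep s hs u v hsu huv hvb := h.indep s ⟨hs.1, hs.2.trans hc⟩ u v hsu huv (hvb.trans hc)
  lintegral_lt_top := (lintegral_mono_set (Icc_subset_Icc_right hc)).trans_lt h.lintegral_lt_top
  memLp s hs := h.memLp s ⟨hs.1, hs.2.trans hc⟩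

theorem IsRegular.exists_eLpNorm_le {g : ℝ → Lp ℝ 2 P} (hg : IsRegular (adaptedL2 P ℱ) g)
    {S : Set ℝ} {ξ : ℝ → Ω → ℝ} (hgξ : ∀ s ∈ S, ξ s =ᵐ[P] g s) :
    ∃ M : ℝ≥0, ∀ s ∈ S, eLpNorm (ξ s) 2 P ≤ M := by
  obtain ⟨M, hM⟩ := hg.bounded
  refine ⟨M.toNNReal, fun s hs => ?_⟩
  rw [eLpNorm_congr_ae (hgξ s hs), ← Lp.enorm_def, ← ofReal_norm]
  exact ENNReal.ofReal_le_ofReal (hM s)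

theorem exists_isStepApprox [IsProbabilityMeasure P] (hf : IsWiener P ℱ T f) {a b : ℝ}
    (ha : 0 ≤ a) (hab : a ≤ b) (hb : b ≤ T) {ξ : ℝ → Ω → ℝ} (hξ : InM2 P ℱ f a b ξ)
    {g : ℝ → Lp ℝ 2 P} (hg : IsRegular (adaptedL2 P ℱ) g) (hgξ : ∀ s ∈ Icc a b, ξ s =ᵐ[P] g s) :
    ∃ τ X, IsStepApprox P ℱ f a b ξ τ X := by
  obtain ⟨τ, hτ⟩ : ∃ τ, IsPartitionSeq a b τ := ⟨_, IsPartitionSeq.uniform hab⟩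
  set X : ℕ → ℝ → Ω → ℝ := fun N s ω => ∑ j ∈ Finset.range N,
    (Ico (τ N j) (τ N (j + 1))).indicator (fun _ => ξ (τ N j) ω) s with hX
  have hact : ∀ N, 1 ≤ N → ∀ j < N, ∀ s ∈ Ico (τ N j) (τ N (j + 1)), X N s = ξ (τ N j) := by
    intro N hN j hj s hs
    ext ω
    exact sum_indicator_Ico_eq (hτ.mono N hN) hj hs fun i => ξ (τ N i) ω
  have hcases : ∀ N, 1 ≤ N → ∀ s, X N s = 0 ∨
      ∃ j < N, s ∈ Ico (τ N j) (τ N (j + 1)) ∧ X N s = ξ (τ N j) := by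
    intro N hN s
    by_cases hs : s ∈ Ico (τ N 0) (τ N N)
    · obtain ⟨j, hj, hj'⟩ := exists_mem_Ico_of_mono (hτ.mono N hN) hs
      exact Or.inr ⟨j, hj, hj', hact N hN j hj s hj'⟩
    · left
      ext ω
      exact sum_indicator_Ico_eq_zero (hτ.mono N hN) hs fun i => ξ (τ N i) ω
  obtain ⟨M, hM⟩ := hg.exists_eLpNorm_le hgξ
  refine ⟨τ, X, hτ, fun N hN => ?_, fun N hN j hj s hs => ?_, ?_⟩
  · refine InM2.of_bound hf ha hb (M := M) ?_ (fun s hs => ?_) (fun s hs => ?_)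
    · refine Finset.measurable_fun_sum _ fun j hj => ?_
      have hj := Finset.mem_range.1 hj
      simp only [indicator_apply]
      refine Measurable.ite ?_ ?_ measurable_const
      · exact (measurable_subtype_coe.comp measurable_fst) measurableSet_Ico
      · exact ((hξ.adapted _ (hτ.mem_Icc hN hj.le)).mono (ℱ.le _) le_rfl).comp measurable_snd
    · rcases hcases N hN s with h | ⟨j, hj, hj', h⟩
      · rw [h]; exact measurable_const
      · rw [h]; exact (hξ.adapted _ (hτ.mem_Icc hN hj.le)).mono (ℱ.mono hj'.1) le_rfl
    · rcases hcases N hN s with h | ⟨j, hj, hj', h⟩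
      · rw [h]; simp
      · rw [h]; exact hM _ (hτ.mem_Icc hN hj.le)
  · rw [hact N hN j hj s hs, hact N hN j hj (τ N j) ⟨le_rfl, hs.1.trans_lt hs.2⟩]
  -- The level b + 1 lies beyond every node, so the stopping condition is always satisfied.
  · have h1 := ENNReal.Tendsto.pow (n := 2) (tendsto_eLpNorm_leftStep (T := T) hτ hg (b + 1))
    simp only [← lintegral_enorm_sq_eq, ne_eq, OfNat.ofNat_ne_zero, not_false_eq_true,
      zero_pow] at h1
    refine tendsto_of_tendsto_of_tendsto_of_le_of_le' tendsto_const_nhds h1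
      (Eventually.of_forall fun _ => zero_le) ?_
    filter_upwards [eventually_ge_atTop 1] with N hN
    refine le_trans ?_ (lintegral_mono_set (Icc_subset_Icc ha hb))
    refine lintegral_mono_ae ?_
    filter_upwards [ae_restrict_mem measurableSet_Icc,
      ae_restrict_of_ae (Measure.ae_ne volume b)] with s hs hsb
    have hs' : s ∈ Ico a b := ⟨hs.1, lt_of_le_of_ne hs.2 hsb⟩
    obtain ⟨j, hj, hj'⟩ := exists_mem_Ico_of_mono (hτ.mono N hN) (s := s)
      (by rwa [hτ.left N hN, hτ.right N hN])
    have h2 : τ N (j + 1) ≤ b + 1 := by linarith [(hτ.mem_Icc hN (j := j + 1) hj).2]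
    rw [Pi.sub_apply, sum_indicator_Ico_eq (hτ.mono N hN) hj hj', if_pos h2,
      indicator_of_mem (show s ∈ Iio (b + 1) by simp only [mem_Iio]; linarith [hs.2]),
      indicator_of_mem hs', hact N hN j hj s hj', lintegral_enorm_sq_eq,
      eLpNorm_sub_eq_enorm (hgξ _ (hτ.mem_Icc hN hj.le)) (hgξ s hs)]

/-- For integrands with a regular mean-square version, the stochastic integral is `ito`. -/
theorem isStochInt_iff [IsProbabilityMeasure P] (hT : 0 ≤ T) (hf : IsWiener P ℱ T f)
    (w : Integrator) {a b : ℝ}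
    (ha : 0 ≤ a) (hab : a ≤ b) (hb : b ≤ T) {ξ : ℝ → Ω → ℝ} (hξ : InM2 P ℱ f a b ξ)
    {g : ℝ → Lp ℝ 2 P} (hg : IsRegular (adaptedL2 P ℱ) g) (hgξ : ∀ s ∈ Icc a b, ξ s =ᵐ[P] g s)
    {I : Ω → ℝ} : IsStochInt P ℱ f w a b ξ I ↔
      I =ᵐ[P] (ito (adaptedL2 P ℱ) (mulIncr P f w) T ((Ico a b).indicator g) : Lp ℝ 2 P) := by
  obtain ⟨K, hD⟩ := exists_isL2Integrator hT hf w
  have key : ∀ τ X, IsStepApprox P ℱ f a b ξ τ X →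
      (IsMSLim P (fun N ω => ∑ j ∈ Finset.range N,
        X N (τ N j) ω * (w.path f (τ N (j + 1)) ω - w.path f (τ N j) ω)) I ↔
      I =ᵐ[P] (ito (adaptedL2 P ℱ) (mulIncr P f w) T ((Ico a b).indicator g) : Lp ℝ 2 P)) := by
    intro τ X hX
    have hτ := hX.partition
    have hxm : ∀ N, 1 ≤ N → ∀ j < N,
        toL2 P (X N (τ N j)) ∈ adaptedL2 P ℱ (τ N j) := fun N hN j hj =>
      toL2_mem ((hX.inM2 N hN).memLp _ (hτ.mem_Icc hN hj.le))
        ((hX.inM2 N hN).adapted _ (hτ.mem_Icc hN hj.le)).stronglyMeasurable.aestronglyMeasurable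
    refine isMSLim_iff (Y := fun N => ∑ j ∈ Finset.range N,
      mulIncr P f w (τ N j) (τ N (j + 1)) (toL2 P (X N (τ N j)))) ?_ ?_
    · filter_upwards [eventually_ge_atTop 1] with N hN
      have h1 : ∀ j ∈ Finset.range N, mulIncr P f w (τ N j) (τ N (j + 1)) (toL2 P (X N (τ N j)))
          =ᵐ[P] fun ω => X N (τ N j) ω * (w.path f (τ N (j + 1)) ω - w.path f (τ N j) ω) := by
        intro j hj
        have hj := Finset.mem_range.1 hj
        filter_upwards [(coeFn_mulIncr hf w (ha.trans (hτ.mem_Icc hN hj.le).1) (hτ.mono N hN j hj)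
          ((hτ.mem_Icc hN (j := j + 1) hj).2.trans hb) (hxm N hN j hj)).2,
          coeFn_toL2 ((hX.inM2 N hN).memLp _ (hτ.mem_Icc hN hj.le))] with ω h1 h2
        rw [h1, h2]
      filter_upwards [(Finset.range N).eventually_all.2 h1, Lp.coeFn_finsetSum (Finset.range N)
        fun j => mulIncr P f w (τ N j) (τ N (j + 1)) (toL2 P (X N (τ N j)))] with ω h2 h3
      rw [h3, Finset.sum_apply]
      exact Finset.sum_congr rfl fun j hj => (h2 j hj).symm
    -- The approximating process is almost surely constant on each partition interval, so as an
    -- L²-valued curve it is the step function built from its left-point values. The assumed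
    -- convergence is then L² convergence in time to g on [a, b).
    · refine (isIto_of_isRegular hD (hg.indicator_Ico a b)).tendsto hD
        (gs := fun N s => ∑ j ∈ Finset.range N, (Ico (τ N j) (τ N (j + 1))).indicator
          (fun _ => toL2 P (X N (τ N j))) s) ?_ ?_
      · filter_upwards [eventually_ge_atTop 1] with N hN
        exact IsIto.of_mem (sum_mem_stepGraph hτ ha hb hN (hxm N hN))
      · have h1 : Tendsto (fun N => (∫⁻ s in Icc a b, ∫⁻ ω, ‖X N s ω - ξ s ω‖ₑ ^ 2 ∂P) ^
            (1 / 2 : ℝ)) atTop (𝓝 0) := by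
          have := ((ENNReal.continuous_rpow_const (y := (1 / 2 : ℝ))).tendsto _).comp hX.tendsto
          simpa [Function.comp_def] using this
        refine tendsto_of_tendsto_of_tendsto_of_le_of_le' tendsto_const_nhds h1
          (Eventually.of_forall fun _ => zero_le) ?_
        filter_upwards [eventually_ge_atTop 1] with N hN
        rw [one_div, ENNReal.le_rpow_inv_iff two_pos, ENNReal.rpow_two, ← lintegral_enorm_sq_eq]
        calc _ ≤ ∫⁻ s in Icc 0 T, (Icc a b).indicator
              (fun s => ∫⁻ ω, ‖X N s ω - ξ s ω‖ₑ ^ 2 ∂P) s := by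
              refine lintegral_mono fun s => ?_
              by_cases hs : s ∈ Ico a b
              · obtain ⟨j, hj, hj'⟩ := exists_mem_Ico_of_mono (hτ.mono N hN) (s := s)
                  (by rwa [hτ.left N hN, hτ.right N hN])
                rw [indicator_of_mem (Ico_subset_Icc_self hs), lintegral_enorm_sq_eq,
                  eLpNorm_sub_eq_enorm (x := toL2 P (X N (τ N j))) _
                    (hgξ s (Ico_subset_Icc_self hs)), Pi.sub_apply,
                  sum_indicator_Ico_eq (hτ.mono N hN) hj hj', indicator_of_mem hs]
                exact (hX.step N hN j hj s hj').trans
                  (coeFn_toL2 ((hX.inM2 N hN).memLp _ (hτ.mem_Icc hN hj.le))).symm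
              · rw [Pi.sub_apply, sum_indicator_Ico_eq_zero (hτ.mono N hN)
                  (by rwa [hτ.left N hN, hτ.right N hN]), indicator_of_notMem hs]
                simp
          _ ≤ ∫⁻ s, (Icc a b).indicator (fun s => ∫⁻ ω, ‖X N s ω - ξ s ω‖ₑ ^ 2 ∂P) s :=
              setLIntegral_le_lintegral _ _
          _ = _ := lintegral_indicator measurableSet_Icc _
  constructor
  · rintro ⟨-, ⟨τ, X, hX⟩, h⟩
    exact (key τ X hX).1 (h τ X hX)
  · intro h
    exact ⟨hξ, exists_isStepApprox hf ha hab hb hξ hg hgξ, fun τ X hX => (key τ X hX).2 h⟩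

end Forward

/-! ### Iterated integrals as bounded linear operators on the innermost integrand. -/

section Iterated

variable {Ω : Type*} [mΩ : MeasurableSpace Ω]

/-- The integrand of the outermost integral in the iterated Ito integral with weights
`ρ q, …, ρ (q + r - 1)` and innermost integrand `φ`. -/
noncomputable def iterIntegrand (P : Measure Ω) (ℱ : Filtration ℝ mΩ) (f : ℝ → Ω → ℝ) (T : ℝ)
    (w : ℕ → Integrator) (ρ : ℕ → ℝ → ℝ) (φ : ℝ → Lp ℝ 2 P) : ℕ → ℕ → ℝ → Lp ℝ 2 P
  | _, 0 => φ
  | q, r + 1 => fun s => ρ q s • primitive (adaptedL2 P ℱ) (mulIncr P f (w (q + 1))) T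
      (iterIntegrand P ℱ f T w ρ φ (q + 1) r) s

/-- The iterated integral of `ξ` over `[0, T]`, with `ξ` integrated against `w (r + 1)` and with
weights `ρ r, …, ρ 1` in the outer integrals. -/
noncomputable def outerInt (P : Measure Ω) (ℱ : Filtration ℝ mΩ) (f : ℝ → Ω → ℝ) (T : ℝ)
    (w : ℕ → Integrator) (ρ : ℕ → ℝ → ℝ) : ℕ → (ℝ → Lp ℝ 2 P) → Lp ℝ 2 P
  | 0, ξ => ito (adaptedL2 P ℱ) (mulIncr P f (w 1)) T ξ
  | r + 1, ξ => outerInt P ℱ f T w ρ r fun s => ρ (r + 1) s •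
      primitive (adaptedL2 P ℱ) (mulIncr P f (w (r + 2))) T ξ s

/-- The iterated integral `Î` from `s` to `T`, as an element of `L²`. -/
noncomputable def hatInt (P : Measure Ω) (ℱ : Filtration ℝ mΩ) (f : ℝ → Ω → ℝ) (T : ℝ)
    (w : ℕ → Integrator) (ρ : ℕ → ℝ → ℝ) : ℕ → ℝ → Lp ℝ 2 P
  | 0, _ => toL2 P fun _ => 1
  | r + 1, s => outerInt P ℱ f T w ρ r
      ((Ici s).indicator fun u => ρ (r + 1) u • toL2 P fun _ => 1)

variable {P : Measure Ω} [IsProbabilityMeasure P] {ℱ : Filtration ℝ mΩ}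
  {f : ℝ → Ω → ℝ} {T : ℝ} {w : ℕ → Integrator} {ρ : ℕ → ℝ → ℝ}

-- Peeling weights from the outside or building layers from the inside gives the same iterated
-- integral; each induction step moves one layer across by definition.
omit [IsProbabilityMeasure P] in
theorem outerInt_iterIntegrand (φ : ℝ → Lp ℝ 2 P) (q r : ℕ) :
    outerInt P ℱ f T w ρ q (iterIntegrand P ℱ f T w ρ φ (q + 1) r) =
      outerInt P ℱ f T w ρ 0 (iterIntegrand P ℱ f T w ρ φ 1 (q + r)) := by
  induction q generalizing r with
  | zero => rw [zero_add, zero_add]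
  | succ q ih =>
    have := ih (r + 1)
    rw [show q + (r + 1) = q + 1 + r by omega] at this
    rw [← this]
    rfl

theorem IsRegular.weighted_primitive (hT : 0 ≤ T) (hf : IsWiener P ℱ T f) (v : Integrator)
    {σ : ℝ → ℝ} (hσ : IsRiemann σ) {ξ : ℝ → Lp ℝ 2 P} (h : IsRegular (adaptedL2 P ℱ) ξ) :
    IsRegular (adaptedL2 P ℱ)
      (fun s => σ s • IterIto.primitive (adaptedL2 P ℱ) (mulIncr P f v) T ξ s) := by
  obtain ⟨K, hD⟩ := exists_isL2Integrator hT hf v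
  exact IsRegular.smul hσ (h.primitive hD)

theorem outerInt_add (hT : 0 ≤ T) (hf : IsWiener P ℱ T f) (r : ℕ)
    (hρ : ∀ l, 1 ≤ l → l ≤ r → IsRiemann (ρ l)) {ξ ξ' : ℝ → Lp ℝ 2 P}
    (h : IsRegular (adaptedL2 P ℱ) ξ) (h' : IsRegular (adaptedL2 P ℱ) ξ') :
    outerInt P ℱ f T w ρ r (fun s => ξ s + ξ' s) =
      outerInt P ℱ f T w ρ r ξ + outerInt P ℱ f T w ρ r ξ' := by
  induction r generalizing ξ ξ' with
  | zero =>
    obtain ⟨K, hD⟩ := exists_isL2Integrator hT hf (w 1)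
    exact ito_add hD h h'
  | succ r ih =>
    obtain ⟨K, hD⟩ := exists_isL2Integrator hT hf (w (r + 2))
    have hr := hρ (r + 1) (by omega) le_rfl
    rw [outerInt, outerInt, outerInt, ← ih (fun l h1 h2 => hρ l h1 (by omega))
      (h.weighted_primitive hT hf _ hr) (h'.weighted_primitive hT hf _ hr)]
    congr 1
    ext1 s
    rw [primitive_add hD h h', smul_add]

theorem exists_enorm_outerInt_le (hT : 0 ≤ T) (hf : IsWiener P ℱ T f) (r : ℕ)
    (hρ : ∀ l, 1 ≤ l → l ≤ r → IsRiemann (ρ l)) :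
    ∃ C : ℝ≥0, ∀ ξ, IsRegular (adaptedL2 P ℱ) ξ →
      ‖outerInt P ℱ f T w ρ r ξ‖ₑ ≤ C * eLpNorm ξ 2 (timeMeasure T) := by
  induction r with
  | zero =>
    obtain ⟨K, hD⟩ := exists_isL2Integrator hT hf (w 1)
    exact ⟨K, fun ξ h => (isIto_of_isRegular hD h).enorm_le hD⟩
  | succ r ih =>
    obtain ⟨C, hC⟩ := ih fun l h1 h2 => hρ l h1 (by omega)
    obtain ⟨K, hD⟩ := exists_isL2Integrator hT hf (w (r + 2))
    have hr := hρ (r + 1) (by omega) le_rfl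
    obtain ⟨R, hR⟩ := hr.bounded
    -- R bounds the weight, K the indefinite integral at every time, and √T comes from integrating a
    -- uniform bound over [0, T].
    refine ⟨C * (R.toNNReal * K * T.toNNReal ^ (1 / 2 : ℝ)), fun ξ h => ?_⟩
    rw [outerInt]
    refine (hC _ (h.weighted_primitive hT hf _ hr)).trans ?_
    rw [ENNReal.coe_mul, mul_assoc]
    gcongr
    refine (eLpNorm_le_of_ae_enorm_bound (C := R.toNNReal * (K * eLpNorm ξ 2 (timeMeasure T)))
      (Eventually.of_forall fun s => ?_)).trans ?_
    · rw [enorm_smul]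
      gcongr
      · rw [← ofReal_norm]
        exact ENNReal.ofReal_le_ofReal (hR s)
      · exact enorm_primitive_le hD h s
    · rw [Measure.restrict_apply_univ, Real.volume_Icc, sub_zero, smul_eq_mul,
        ENNReal.coe_mul, ENNReal.coe_mul, ENNReal.coe_rpow_of_nonneg _ (by norm_num),
        ENNReal.ofReal]
      simp only [ENNReal.toReal_ofNat, one_div]
      refine le_of_eq ?_
      ring

theorem outerInt_sub (hT : 0 ≤ T) (hf : IsWiener P ℱ T f) (r : ℕ)
    (hρ : ∀ l, 1 ≤ l → l ≤ r → IsRiemann (ρ l)) {ξ ξ' : ℝ → Lp ℝ 2 P}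
    (h : IsRegular (adaptedL2 P ℱ) ξ) (h' : IsRegular (adaptedL2 P ℱ) ξ') :
    outerInt P ℱ f T w ρ r (fun s => ξ s - ξ' s) =
      outerInt P ℱ f T w ρ r ξ - outerInt P ℱ f T w ρ r ξ' := by
  rw [eq_sub_iff_add_eq, ← outerInt_add hT hf r hρ (h.sub h') h']
  simp only [sub_add_cancel]

theorem outerInt_sum (hT : 0 ≤ T) (hf : IsWiener P ℱ T f) (r : ℕ)
    (hρ : ∀ l, 1 ≤ l → l ≤ r → IsRiemann (ρ l)) {ι : Type*} (S : Finset ι)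
    {F : ι → ℝ → Lp ℝ 2 P} (h : ∀ i ∈ S, IsRegular (adaptedL2 P ℱ) (F i)) :
    outerInt P ℱ f T w ρ r (fun s => ∑ i ∈ S, F i s) =
      ∑ i ∈ S, outerInt P ℱ f T w ρ r (F i) := by
  classical
  induction S using Finset.induction_on with
  | empty =>
    have h0 := IsRegular.zero (V := adaptedL2 P ℱ)
    simpa using outerInt_sub (w := w) hT hf r hρ h0 h0
  | insert i S hi ih =>
    have hS := fun j hj => h j (Finset.mem_insert_of_mem hj)
    simp only [Finset.sum_insert hi]
    rw [outerInt_add hT hf r hρ (h i (Finset.mem_insert_self i S)) (IsRegular.sum S hS), ih hS]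

theorem outerInt_tendsto (hT : 0 ≤ T) (hf : IsWiener P ℱ T f) (r : ℕ)
    (hρ : ∀ l, 1 ≤ l → l ≤ r → IsRiemann (ρ l)) {ξ : ℝ → Lp ℝ 2 P} {ξs : ℕ → ℝ → Lp ℝ 2 P}
    (h : IsRegular (adaptedL2 P ℱ) ξ) (hs : ∀ᶠ N in atTop, IsRegular (adaptedL2 P ℱ) (ξs N))
    (hlim : Tendsto (fun N => eLpNorm (fun u => ξs N u - ξ u) 2 (timeMeasure T)) atTop (𝓝 0)) :
    Tendsto (fun N => outerInt P ℱ f T w ρ r (ξs N)) atTop (𝓝 (outerInt P ℱ f T w ρ r ξ)) := by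
  obtain ⟨C, hC⟩ := exists_enorm_outerInt_le (w := w) hT hf r hρ
  rw [tendsto_iff_edist_tendsto_0]
  have h2 : Tendsto (fun n => C * eLpNorm (fun u => ξs n u - ξ u) 2 (timeMeasure T))
      atTop (𝓝 0) := by
    simpa using ENNReal.Tendsto.const_mul hlim (Or.inr (ENNReal.coe_ne_top (r := C)))
  refine tendsto_of_tendsto_of_tendsto_of_le_of_le' tendsto_const_nhds h2
    (Eventually.of_forall fun _ => zero_le) ?_
  filter_upwards [hs] with N hN
  rw [edist_eq_enorm_sub, ← outerInt_sub hT hf r hρ hN h]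
  exact hC _ (hN.sub h)

section PullOut

omit [IsProbabilityMeasure P] in
/-- Multiplication by a fixed function passes to mean-square limits. -/
theorem ae_eq_mul_of_tendsto {Y Y' : ℕ → Lp ℝ 2 P} {X X' : Lp ℝ 2 P} {x : Ω → ℝ}
    (hY : Tendsto Y atTop (𝓝 X)) (hY' : Tendsto Y' atTop (𝓝 X'))
    (h : ∀ᶠ N in atTop, Y' N =ᵐ[P] fun ω => x ω * Y N ω) : X' =ᵐ[P] fun ω => x ω * X ω := by
  -- Since x may be unbounded, multiplication by x is not continuous on L². The identity is passed
  -- to the limit almost surely, along a common subsequence.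
  obtain ⟨ns, hns, h1⟩ := (tendstoInMeasure_of_tendsto_Lp hY).exists_seq_tendsto_ae
  obtain ⟨ms, hms, h2⟩ := (tendstoInMeasure_of_tendsto_Lp
    (hY'.comp hns.tendsto_atTop)).exists_seq_tendsto_ae
  obtain ⟨N, hN⟩ := eventually_atTop.1 h
  have h3 : ∀ᵐ ω ∂P, ∀ n, N ≤ n → Y' n ω = x ω * Y n ω :=
    ae_all_iff.2 fun n => by
      by_cases hn : N ≤ n
      · filter_upwards [hN n hn] with ω hω _ using hω
      · exact Eventually.of_forall fun _ h => absurd h hn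
  filter_upwards [h1, h2, h3] with ω h4 h5 h6
  refine tendsto_nhds_unique h5 (((h4.comp hms.tendsto_atTop).const_mul (x ω)).congr' ?_)
  filter_upwards [eventually_ge_atTop N] with n hn
  exact (h6 _ (hn.trans ((hms.id_le n).trans (hns.id_le _)))).symm

/-- The factor x commutes with left-point sums term by term. No measurability of x itself is asked:
what matters is that both ξ and xξ are adapted, as in the case where ξ vanishes before x is known.
-/
theorem ito_ae_eq_mul (hT : 0 ≤ T) (hf : IsWiener P ℱ T f) (v : Integrator) {x : Ω → ℝ}
    {ξ ξ' : ℝ → Lp ℝ 2 P} (h : IsRegular (adaptedL2 P ℱ) ξ) (h' : IsRegular (adaptedL2 P ℱ) ξ')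
    (hx : ∀ s, ξ' s =ᵐ[P] fun ω => x ω * ξ s ω) :
    (ito (adaptedL2 P ℱ) (mulIncr P f v) T ξ' : Lp ℝ 2 P) =ᵐ[P]
      fun ω => x ω * (ito (adaptedL2 P ℱ) (mulIncr P f v) T ξ : Lp ℝ 2 P) ω := by
  obtain ⟨K, hD⟩ := exists_isL2Integrator hT hf v
  have key : ∀ {ξ}, IsRegular (adaptedL2 P ℱ) ξ →
      ito (adaptedL2 P ℱ) (mulIncr P f v) T ((Ico 0 T).indicator ξ) =
      ito (adaptedL2 P ℱ) (mulIncr P f v) T ξ := fun {ξ} h => by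
    refine ito_congr_ae hD h ?_
    filter_upwards [Ico_ae_eq_restrict] with s hs
    rw [indicator_of_mem hs]
  have hτ := IsPartitionSeq.uniform hT
  have h1 := tendsto_leftSum hD h hτ le_rfl le_rfl
  have h2 := tendsto_leftSum hD h' hτ le_rfl le_rfl
  rw [key h] at h1
  rw [key h'] at h2
  refine ae_eq_mul_of_tendsto h1 h2 ?_
  filter_upwards [eventually_ge_atTop 1] with N hN
  have hc : ∀ {ξ}, IsRegular (adaptedL2 P ℱ) ξ → ∀ j ∈ Finset.range N, _ := fun {ξ} h j hj =>
    (coeFn_mulIncr hf v (hτ.mem_Icc hN (Finset.mem_range.1 hj).le).1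
      (hτ.mono N hN j (Finset.mem_range.1 hj))
      (hτ.mem_Icc hN (j := j + 1) (Finset.mem_range.1 hj)).2 (h.adapted _)).2
  filter_upwards [(Finset.range N).eventually_all.2 (hc h),
    (Finset.range N).eventually_all.2 (hc h'),
    (Finset.range N).eventually_all.2 fun j _ => hx (0 + (T - 0) * ((j : ℝ) / (N : ℝ))),
    Lp.coeFn_finsetSum (Finset.range N) fun j => mulIncr P f v _ _ (ξ _),
    Lp.coeFn_finsetSum (Finset.range N) fun j => mulIncr P f v _ _ (ξ' _)] with ω h1 h2 h3 h4 h5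
  rw [h4, h5, Finset.sum_apply, Finset.sum_apply, Finset.mul_sum]
  refine Finset.sum_congr rfl fun j hj => ?_
  rw [h1 j hj, h2 j hj, h3 j hj]
  ring

omit [IsProbabilityMeasure P] in
theorem indicator_ae_eq_mul {x : Ω → ℝ} {ξ ξ' : ℝ → Lp ℝ 2 P}
    (hx : ∀ s, ξ' s =ᵐ[P] fun ω => x ω * ξ s ω) (S : Set ℝ) (s : ℝ) :
    (S.indicator ξ' s : Lp ℝ 2 P) =ᵐ[P] fun ω => x ω * (S.indicator ξ s : Lp ℝ 2 P) ω := by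
  by_cases hs : s ∈ S
  · simpa only [indicator_of_mem hs] using hx s
  · rw [indicator_of_notMem hs, indicator_of_notMem hs]
    filter_upwards [Lp.coeFn_zero ℝ 2 P] with ω h
    rw [h]; simp

omit [IsProbabilityMeasure P] in
theorem smul_ae_eq_mul {x : Ω → ℝ} {y y' : Lp ℝ 2 P} (hx : y' =ᵐ[P] fun ω => x ω * y ω) (c : ℝ) :
    (c • y' : Lp ℝ 2 P) =ᵐ[P] fun ω => x ω * (c • y : Lp ℝ 2 P) ω := by
  filter_upwards [hx, Lp.coeFn_smul c y, Lp.coeFn_smul c y'] with ω h1 h2 h3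
  rw [h2, h3, Pi.smul_apply, Pi.smul_apply, h1, smul_eq_mul, smul_eq_mul]
  ring

theorem outerInt_ae_eq_mul (hT : 0 ≤ T) (hf : IsWiener P ℱ T f) (r : ℕ)
    (hρ : ∀ l, 1 ≤ l → l ≤ r → IsRiemann (ρ l)) {x : Ω → ℝ}
    {ξ ξ' : ℝ → Lp ℝ 2 P} (h : IsRegular (adaptedL2 P ℱ) ξ) (h' : IsRegular (adaptedL2 P ℱ) ξ')
    (hx : ∀ s, ξ' s =ᵐ[P] fun ω => x ω * ξ s ω) :
    outerInt P ℱ f T w ρ r ξ' =ᵐ[P] fun ω => x ω * outerInt P ℱ f T w ρ r ξ ω := by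
  induction r generalizing ξ ξ' with
  | zero => exact ito_ae_eq_mul hT hf _ h h' hx
  | succ r ih =>
    have hr := hρ (r + 1) (by omega) le_rfl
    exact ih (fun l h1 h2 => hρ l h1 (by omega)) (h.weighted_primitive hT hf _ hr)
      (h'.weighted_primitive hT hf _ hr) fun s => smul_ae_eq_mul (ito_ae_eq_mul hT hf _
        (h.indicator_Iio s) (h'.indicator_Iio s) (indicator_ae_eq_mul hx (Iio s))) _

end PullOut

end Iterated

/-! ### Exchanging the order of integration, and the identification of all integrals. -/

section Combined

variable {Ω : Type*} [mΩ : MeasurableSpace Ω] {P : Measure Ω} [IsProbabilityMeasure P]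
  {ℱ : Filtration ℝ mΩ} {f : ℝ → Ω → ℝ} {T : ℝ} {w : ℕ → Integrator} {ρ : ℕ → ℝ → ℝ}

/-- The elementary bound is uniform in the partition and in the stopping time. It provides the
domination when the limit is taken inside the outer integrals. -/
theorem exists_norm_stoppedSum_le {H : Type*} [NormedAddCommGroup H] [NormedSpace ℝ H]
    {V : ℝ → Submodule ℝ H} {D : ℝ → ℝ → H → H} {K : ℝ≥0} (hD : IsL2Integrator V D T K)
    {g : ℝ → H} (h : IsRegular V g) {a b : ℝ} {τ : ℕ → ℕ → ℝ} (hτ : IsPartitionSeq a b τ)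
    (ha : 0 ≤ a) (hb : b ≤ T) : ∃ M : ℝ, ∀ N, 1 ≤ N → ∀ u, ‖∑ j ∈ Finset.range N,
      D (τ N j) (τ N (j + 1)) (if τ N (j + 1) ≤ u then g (τ N j) else 0)‖ ≤ M := by
  obtain ⟨M, hM⟩ := h.bounded
  have hM0 : 0 ≤ M := (norm_nonneg _).trans (hM 0)
  set B : ℝ≥0∞ := K * ((timeMeasure T) univ ^ (2 : ℝ≥0∞).toReal⁻¹ * ENNReal.ofReal M) with hB
  have hB' : B ≠ ∞ := by
    refine ENNReal.mul_ne_top ENNReal.coe_ne_top (ENNReal.mul_ne_top ?_ ENNReal.ofReal_ne_top)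
    exact ENNReal.rpow_ne_top_of_nonneg (by simp) (measure_ne_top _ _)
  refine ⟨B.toReal, fun N hN u => ?_⟩
  rw [← toReal_enorm]
  refine ENNReal.toReal_mono hB' ?_
  refine (hD.bound _ (sum_mem_stepGraph hτ ha hb hN (x := fun j =>
    if τ N (j + 1) ≤ u then g (τ N j) else 0) fun j hj => ?_)).trans ?_
  · split_ifs
    · exact h.adapted _
    · exact zero_mem _
  · rw [hB]
    gcongr
    refine eLpNorm_le_of_ae_bound (Eventually.of_forall fun s => ?_)
    refine norm_sum_indicator_Ico_le (hτ.mono N hN) s (fun i _ => ?_) hM0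
    split_ifs
    · exact hM _
    · simpa using hM0

theorem coeFn_toL2_const (c : ℝ) : toL2 P (fun _ => c) =ᵐ[P] fun _ => c :=
  coeFn_toL2 (memLp_const c)

theorem isRegular_weight_one {σ : ℝ → ℝ} (hσ : IsRiemann σ) :
    IsRegular (adaptedL2 P ℱ) fun u => σ u • toL2 P fun _ => 1 := by
  refine IsRegular.smul hσ ⟨⟨⟨_, fun _ => le_rfl⟩, Eventually.of_forall fun _ =>
    continuousAt_const⟩, fun s => toL2_mem (memLp_const 1) aestronglyMeasurable_const⟩

theorem IsL2Integrator.apply_zero {H : Type*} [NormedAddCommGroup H] [NormedSpace ℝ H]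
    {V : ℝ → Submodule ℝ H} {D : ℝ → ℝ → H → H} {K : ℝ≥0} (hD : IsL2Integrator V D T K)
    {c d : ℝ} (hc : 0 ≤ c) (hcd : c ≤ d) (hd : d ≤ T) : D c d 0 = 0 := by
  have h1 := hD.bound _ (mem_stepGraph (D := D) hc hcd hd (zero_mem (V c)))
  simpa using h1

/-- The sums defining the combined integral converge in mean square to the iterated integral. -/
theorem exists_tendsto_combinedSum (hT : 0 ≤ T) (hf : IsWiener P ℱ T f) (r : ℕ)
    (hρ : ∀ l, 1 ≤ l → l ≤ r → IsRiemann (ρ l)) {g : ℝ → Lp ℝ 2 P}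
    (hg : IsRegular (adaptedL2 P ℱ) g) {a : ℝ} (ha : 0 ≤ a) {τ : ℕ → ℕ → ℝ}
    (hτ : IsPartitionSeq a T τ) :
    ∃ Y : ℕ → Lp ℝ 2 P,
      (∀ N, 1 ≤ N → Y N =ᵐ[P] fun ω => ∑ l ∈ Finset.range N, g (τ N l) ω *
        ((w (r + 1)).path f (τ N (l + 1)) ω - (w (r + 1)).path f (τ N l) ω) *
        hatInt P ℱ f T w ρ r (τ N (l + 1)) ω) ∧
      Tendsto Y atTop (𝓝 (outerInt P ℱ f T w ρ r ((Ici a).indicator g))) := by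
  obtain ⟨K, hD⟩ := exists_isL2Integrator hT hf (w (r + 1))
  have hx : ∀ N, 1 ≤ N → ∀ l ∈ Finset.range N,
      mulIncr P f (w (r + 1)) (τ N l) (τ N (l + 1)) (g (τ N l)) =ᵐ[P] fun ω => g (τ N l) ω *
        ((w (r + 1)).path f (τ N (l + 1)) ω - (w (r + 1)).path f (τ N l) ω) := fun N hN l hl =>
    (coeFn_mulIncr hf _ (ha.trans (hτ.mem_Icc hN (Finset.mem_range.1 hl).le).1)
      (hτ.mono N hN l (Finset.mem_range.1 hl))
      (hτ.mem_Icc hN (j := l + 1) (Finset.mem_range.1 hl)).2 (hg.adapted _)).2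
  have hrestr : ∀ᵐ s ∂timeMeasure T, (Ico a T).indicator g s = (Ici a).indicator g s := by
    filter_upwards [Ico_ae_eq_restrict] with s hs
    simp only [indicator_apply, mem_Ico, mem_Ici, hs.2, and_true]
  have hga : IsRegular (adaptedL2 P ℱ) ((Ici a).indicator g) := hg.indicator (by simp)
  cases r with
  | zero =>
    refine ⟨fun N => ∑ l ∈ Finset.range N, mulIncr P f (w 1) (τ N l) (τ N (l + 1)) (g (τ N l)),
      fun N hN => ?_, ?_⟩
    · filter_upwards [(Finset.range N).eventually_all.2 (hx N hN), coeFn_toL2_const (P := P) 1,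
        Lp.coeFn_finsetSum (Finset.range N) fun l => mulIncr P f (w 1) (τ N l) (τ N (l + 1))
          (g (τ N l))] with ω h1 h2 h3
      rw [h3, Finset.sum_apply]
      refine Finset.sum_congr rfl fun l hl => ?_
      rw [h1 l hl, hatInt, h2, mul_one]
    · have h1 := tendsto_leftSum hD hg hτ ha le_rfl
      rwa [ito_congr_ae hD hga (hrestr.mono fun _ h => h.symm)] at h1
  | succ r =>
    have hr := hρ (r + 1) (by omega) le_rfl
    have hρ' : ∀ l, 1 ≤ l → l ≤ r → IsRiemann (ρ l) := fun l h1 h2 => hρ l h1 (by omega)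
    set x : ℕ → ℕ → Lp ℝ 2 P := fun N l =>
      mulIncr P f (w (r + 2)) (τ N l) (τ N (l + 1)) (g (τ N l)) with hxdef
    have hxm : ∀ N, 1 ≤ N → ∀ l ∈ Finset.range N, x N l ∈ adaptedL2 P ℱ (τ N (l + 1)) :=
      fun N hN l hl => hD.mem _ _ _ (ha.trans (hτ.mem_Icc hN (Finset.mem_range.1 hl).le).1)
        (hτ.mono N hN l (Finset.mem_range.1 hl))
        (hτ.mem_Icc hN (j := l + 1) (Finset.mem_range.1 hl)).2 (hg.adapted _)
    have hjump : ∀ N, 1 ≤ N → ∀ l ∈ Finset.range N, IsRegular (adaptedL2 P ℱ)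
        (fun u => ρ (r + 1) u • (Ici (τ N (l + 1))).indicator (fun _ => x N l) u) :=
      fun N hN l hl => IsRegular.smul hr
        (IsRegular.indicator_Ici_const adaptedL2_mono (hxm N hN l hl))
    have hstart : ∀ c, IsRegular (adaptedL2 P ℱ)
        ((Ici c).indicator fun u => ρ (r + 1) u • toL2 P fun _ => 1) := fun c =>
      (isRegular_weight_one hr).indicator (by simp)
    refine ⟨fun N => outerInt P ℱ f T w ρ r fun u => ∑ l ∈ Finset.range N,
      ρ (r + 1) u • (Ici (τ N (l + 1))).indicator (fun _ => x N l) u, fun N hN => ?_, ?_⟩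
    · beta_reduce
      rw [outerInt_sum hT hf r hρ' _ (hjump N hN)]
      -- The integrand of Î at τ_{l+1} vanishes before τ_{l+1}, when x_l becomes known, so
      -- multiplying it by x_l keeps it adapted and x_l can be taken inside.
      have h1 : ∀ l ∈ Finset.range N, outerInt P ℱ f T w ρ r
          (fun u => ρ (r + 1) u • (Ici (τ N (l + 1))).indicator (fun _ => x N l) u) =ᵐ[P]
          fun ω => x N l ω * hatInt P ℱ f T w ρ (r + 1) (τ N (l + 1)) ω := fun l hl => by
        refine outerInt_ae_eq_mul hT hf r hρ' (hstart _) (hjump N hN l hl) fun s => ?_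
        have h2 : (ρ (r + 1) s • (Ici (τ N (l + 1))).indicator (fun _ => x N l) s) =
            (Ici (τ N (l + 1))).indicator (fun u => ρ (r + 1) u • x N l) s := by
          simp only [indicator_apply, smul_ite, smul_zero]
        rw [h2]
        refine indicator_ae_eq_mul (fun u => smul_ae_eq_mul ?_ _) _ _
        filter_upwards [coeFn_toL2_const (P := P) 1] with ω h3
        rw [h3, mul_one]
      filter_upwards [(Finset.range N).eventually_all.2 (hx N hN),
        (Finset.range N).eventually_all.2 h1,
        Lp.coeFn_finsetSum (Finset.range N) fun l => outerInt P ℱ f T w ρ r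
          (fun u => ρ (r + 1) u • (Ici (τ N (l + 1))).indicator (fun _ => x N l) u)]
        with ω h2 h3 h4
      rw [h4, Finset.sum_apply]
      refine Finset.sum_congr rfl fun l hl => ?_
      rw [h3 l hl, h2 l hl]
    -- The jumps that have occurred by time u add up to the stopped left-point sum at u.
    · have hA : ∀ N, 1 ≤ N → ∀ u, ∑ l ∈ Finset.range N,
          ρ (r + 1) u • (Ici (τ N (l + 1))).indicator (fun _ => x N l) u =
          ρ (r + 1) u • ∑ l ∈ Finset.range N, mulIncr P f (w (r + 2)) (τ N l) (τ N (l + 1))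
            (if τ N (l + 1) ≤ u then g (τ N l) else 0) := by
        intro N hN u
        rw [Finset.smul_sum]
        refine Finset.sum_congr rfl fun l hl => ?_
        have hl := Finset.mem_range.1 hl
        by_cases h : τ N (l + 1) ≤ u
        · rw [if_pos h, indicator_of_mem (show u ∈ Ici _ from h)]
        · rw [if_neg h, indicator_of_notMem (show u ∉ Ici _ from h),
            hD.apply_zero (ha.trans (hτ.mem_Icc hN hl.le).1)
              (hτ.mono N hN l hl) (hτ.mem_Icc hN (j := l + 1) hl).2]
      have hreg : ∀ N, 1 ≤ N → IsRegular (adaptedL2 P ℱ) (fun u => ∑ l ∈ Finset.range N,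
          ρ (r + 1) u • (Ici (τ N (l + 1))).indicator (fun _ => x N l) u) := fun N hN =>
        IsRegular.sum _ (hjump N hN)
      have hlim := hga.weighted_primitive hT hf (w (r + 2)) hr
      refine outerInt_tendsto hT hf r hρ' hlim (eventually_atTop.2 ⟨1, hreg⟩) ?_
      obtain ⟨M, hM⟩ := exists_norm_stoppedSum_le hD hg hτ ha le_rfl
      obtain ⟨R, hR⟩ := hr.bounded
      obtain ⟨L, hL⟩ := hlim.bounded
      refine tendsto_eLpNorm_two_zero_of_bounded (M := R * M + L) ?_ ?_
        (Eventually.of_forall fun u => ?_)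
      · filter_upwards [eventually_ge_atTop 1] with N hN
        exact ((hreg N hN).sub hlim).aestronglyMeasurable
      · filter_upwards [eventually_ge_atTop 1] with N hN
        refine Eventually.of_forall fun u => norm_sub_le_of_le ?_ (hL u)
        rw [hA N hN, norm_smul]
        exact mul_le_mul (hR u) (hM N hN u) (norm_nonneg _) ((norm_nonneg _).trans (hR u))
      · have h1 := tendsto_leftSum_stopped hD hg hτ ha le_rfl u
        have h2 : ito (adaptedL2 P ℱ) (mulIncr P f (w (r + 2))) T
            ((Iio u).indicator ((Ico a T).indicator g)) = primitive (adaptedL2 P ℱ)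
            (mulIncr P f (w (r + 2))) T ((Ici a).indicator g) u := by
          refine ito_congr_ae hD (hga.indicator_Iio u) ?_
          filter_upwards [hrestr] with s hs
          simp only [indicator_apply (Iio u), hs]
        rw [h2] at h1
        have h3 := (h1.const_smul (ρ (r + 1) u)).sub_const (ρ (r + 1) u • primitive
          (adaptedL2 P ℱ) (mulIncr P f (w (r + 2))) T ((Ici a).indicator g) u)
        rw [sub_self] at h3
        refine h3.congr' ?_
        filter_upwards [eventually_ge_atTop 1] with N hN
        rw [hA N hN]

theorem isCombinedInt_iff (hT : 0 ≤ T) (hf : IsWiener P ℱ T f) (r : ℕ)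
    (hρ : ∀ l, 1 ≤ l → l ≤ r → IsRiemann (ρ l)) {g : ℝ → Lp ℝ 2 P}
    (hg : IsRegular (adaptedL2 P ℱ) g) {a : ℝ} (ha : 0 ≤ a) (haT : a ≤ T)
    {φ Z : ℝ → Ω → ℝ} (hφ : ∀ u ∈ Icc a T, φ u =ᵐ[P] g u)
    (hZ : ∀ u ∈ Icc a T, Z u =ᵐ[P] hatInt P ℱ f T w ρ r u) {J : Ω → ℝ} :
    IsCombinedInt P f (w (r + 1)) a T φ Z J ↔
      J =ᵐ[P] outerInt P ℱ f T w ρ r ((Ici a).indicator g) := by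
  have key : ∀ τ, IsPartitionSeq a T τ → (IsMSLim P (fun N ω => ∑ l ∈ Finset.range N,
      φ (τ N l) ω * ((w (r + 1)).path f (τ N (l + 1)) ω - (w (r + 1)).path f (τ N l) ω) *
        Z (τ N (l + 1)) ω) J ↔ J =ᵐ[P] outerInt P ℱ f T w ρ r ((Ici a).indicator g)) := by
    intro τ hτ
    obtain ⟨Y, hY, hlim⟩ := exists_tendsto_combinedSum (w := w) hT hf r hρ hg ha hτ
    refine isMSLim_iff ?_ hlim
    filter_upwards [eventually_ge_atTop 1] with N hN
    refine EventuallyEq.trans ?_ (hY N hN).symm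
    filter_upwards [(Finset.range N).eventually_all.2 fun l hl =>
        hφ (τ N l) (hτ.mem_Icc hN (Finset.mem_range.1 hl).le),
      (Finset.range N).eventually_all.2 fun l hl =>
        hZ (τ N (l + 1)) (hτ.mem_Icc hN (j := l + 1) (Finset.mem_range.1 hl))] with ω h1 h2
    exact Finset.sum_congr rfl fun l hl => by rw [h1 l hl, h2 l hl]
  have hτ := IsPartitionSeq.uniform haT
  exact ⟨fun h => (key _ hτ).1 (h _ hτ), fun h τ hτ => (key τ hτ).2 h⟩

/-- Each layer is a combined integral whose left factor is the deterministic weight, so induction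
applies `isCombinedInt_iff` with the constant 1 times that weight. -/
theorem isHatI_iff {t : ℝ} (ht : 0 ≤ t) (htT : t ≤ T) (hf : IsWiener P ℱ T f)
    {ψ : ℕ → ℝ → ℝ} (r : ℕ) (hψ : ∀ l, 1 ≤ l → l ≤ r → ContinuousOn (ψ l) (Icc t T))
    {s : ℝ} (hs : s ∈ Icc t T) {I : Ω → ℝ} :
    IsHatI P f ψ w T r s I ↔
      I =ᵐ[P] hatInt P ℱ f T w (fun l => (Icc t T).indicator (ψ l)) r s := by
  have hT := ht.trans htT
  induction r generalizing s I with
  | zero =>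
    have h1 := coeFn_toL2_const (P := P) 1
    exact ⟨fun h => EventuallyEq.trans h h1.symm, fun h => EventuallyEq.trans h h1⟩
  | succ r ih =>
    have ih' := fun u (hu : u ∈ Icc s T) I =>
      ih (fun l h1 h2 => hψ l h1 (by omega)) (s := u) ⟨hs.1.trans hu.1, hu.2⟩ (I := I)
    have hρ : ∀ l, 1 ≤ l → l ≤ r + 1 → IsRiemann ((Icc t T).indicator (ψ l)) := fun l h1 h2 =>
      IsRiemann.of_continuousOn (hψ l h1 h2)
    have key : ∀ Z : ℝ → Ω → ℝ, (∀ u ∈ Icc s T, IsHatI P f ψ w T r u (Z u)) →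
        (IsCombinedInt P f (w (r + 1)) s T (fun u _ => ψ (r + 1) u) Z I ↔
        I =ᵐ[P] hatInt P ℱ f T w (fun l => (Icc t T).indicator (ψ l)) (r + 1) s) := fun Z hZ =>
      isCombinedInt_iff hT hf r (fun l h1 h2 => hρ l h1 (by omega))
        (isRegular_weight_one (hρ (r + 1) (by omega) le_rfl)) (ht.trans hs.1) hs.2
        (fun u hu => by
          rw [indicator_of_mem (show u ∈ Icc t T from ⟨hs.1.trans hu.1, hu.2⟩)]
          filter_upwards [coeFn_toL2_const (P := P) 1,
            Lp.coeFn_smul (ψ (r + 1) u) (toL2 P fun _ => 1)] with ω h1 h2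
          rw [h2, Pi.smul_apply, h1, smul_eq_mul, mul_one])
        (fun u hu => (ih' u hu _).1 (hZ u hu))
    constructor
    · rintro ⟨Z, hZ, hC⟩
      exact (key Z hZ).1 hC
    · intro h
      have hZ : ∀ u ∈ Icc s T, IsHatI P f ψ w T r u
          (hatInt P ℱ f T w (fun l => (Icc t T).indicator (ψ l)) r u) := fun u hu =>
        (ih' u hu _).2 (EventuallyEq.refl _ _)
      exact ⟨_, hZ, (key _ hZ).2 h⟩

theorem isRegular_iterIntegrand (hT : 0 ≤ T) (hf : IsWiener P ℱ T f) {g : ℝ → Lp ℝ 2 P}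
    (hg : IsRegular (adaptedL2 P ℱ) g) (q r : ℕ)
    (hρ : ∀ l, q ≤ l → l < q + r → IsRiemann (ρ l)) :
    IsRegular (adaptedL2 P ℱ) (iterIntegrand P ℱ f T w ρ g q r) := by
  induction r generalizing q with
  | zero => exact hg
  | succ r ih =>
    exact (ih (q + 1) fun l h1 h2 => hρ l (by omega) (by omega)).weighted_primitive hT hf _
      (hρ q le_rfl (by omega))

/-- The iterated Ito integral as an element of `L²`. -/
theorem isIterInt_iff {t : ℝ} (ht : 0 ≤ t) (htT : t ≤ T) (hf : IsWiener P ℱ T f)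
    {ψ : ℕ → ℝ → ℝ} {φ : ℝ → Ω → ℝ} (hφ : InM2 P ℱ f t T φ) {g : ℝ → Lp ℝ 2 P}
    (hg : IsRegular (adaptedL2 P ℱ) g) (hφg : ∀ u ∈ Icc t T, φ u =ᵐ[P] g u)
    (hg0 : ∀ u < t, g u = 0) (q r : ℕ)
    (hψ : ∀ l, q ≤ l → l < q + r → ContinuousOn (ψ l) (Icc t T))
    {s : ℝ} (hs : s ∈ Icc t T) {J : Ω → ℝ} :
    IsIterInt P ℱ f φ ψ w t q r s J ↔
      J =ᵐ[P] (primitive (adaptedL2 P ℱ) (mulIncr P f (w q)) T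
        (iterIntegrand P ℱ f T w (fun l => (Icc t T).indicator (ψ l)) g q r) s : Lp ℝ 2 P) := by
  have hT := ht.trans htT
  -- Indefinite integrals start at time 0; for integrands vanishing before t this is the same as
  -- starting at t.
  have hprim : ∀ (v : Integrator) {G : ℝ → Lp ℝ 2 P} {s : ℝ},
      (∀ u < t, G u = 0) → primitive (adaptedL2 P ℱ) (mulIncr P f v) T G s =
      ito (adaptedL2 P ℱ) (mulIncr P f v) T ((Ico t s).indicator G) := by
    intro v G s hG0
    rw [primitive]
    congr 1
    ext1 u
    by_cases hu : u < t
    · simp only [indicator_apply, hG0 u hu, ite_self]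
    · simp only [indicator_apply, mem_Iio, mem_Ico, not_lt.1 hu, true_and]
  have hreg : ∀ (r q : ℕ), (∀ l, q ≤ l → l < q + r → ContinuousOn (ψ l) (Icc t T)) →
      IsRegular (adaptedL2 P ℱ)
        (iterIntegrand P ℱ f T w (fun l => (Icc t T).indicator (ψ l)) g q r) := fun r q hψ =>
    isRegular_iterIntegrand hT hf hg q r fun l h1 h2 => IsRiemann.of_continuousOn (hψ l h1 h2)
  have hzero : ∀ (r q : ℕ), ∀ u < t,
      iterIntegrand P ℱ f T w (fun l => (Icc t T).indicator (ψ l)) g q r u = 0 := by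
    intro r q u hu
    cases r with
    | zero => exact hg0 u hu
    | succ r =>
      rw [iterIntegrand]
      beta_reduce
      rw [indicator_of_notMem (fun hu' => absurd hu'.1 (not_le.2 hu)), zero_smul]
  induction r generalizing q s J with
  | zero =>
    rw [hprim _ (hzero 0 q)]
    exact isStochInt_iff hT hf _ ht hs.1 hs.2 (hφ.mono_right hs.2) hg
      fun u hu => hφg u ⟨hu.1, hu.2.trans hs.2⟩
  | succ r ih =>
    have hψ' : ∀ l, q + 1 ≤ l → l < q + 1 + r → ContinuousOn (ψ l) (Icc t T) :=
      fun l h1 h2 => hψ l (by omega) (by omega)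
    have hψq : ContinuousOn (ψ q) (Icc t T) := hψ q le_rfl (by omega)
    have ih' := fun u (hu : u ∈ Icc t s) I =>
      ih (q + 1) hψ' (s := u) ⟨hu.1, hu.2.trans hs.2⟩ (J := I)
    have hR := hreg (r + 1) q hψ
    have hR' := hreg r (q + 1) hψ'
    rw [hprim _ (hzero (r + 1) q)]
    have hver : ∀ Z : ℝ → Ω → ℝ, (∀ u ∈ Icc t s, Z u =ᵐ[P] (primitive (adaptedL2 P ℱ)
        (mulIncr P f (w (q + 1))) T
        (iterIntegrand P ℱ f T w (fun l => (Icc t T).indicator (ψ l)) g (q + 1) r) u :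
          Lp ℝ 2 P)) →
        ∀ u ∈ Icc t s, (fun ω => ψ q u * Z u ω) =ᵐ[P]
          iterIntegrand P ℱ f T w (fun l => (Icc t T).indicator (ψ l)) g q (r + 1) u := by
      intro Z hZ u hu
      rw [iterIntegrand]
      beta_reduce
      rw [indicator_of_mem (show u ∈ Icc t T from ⟨hu.1, hu.2.trans hs.2⟩)]
      filter_upwards [hZ u hu, Lp.coeFn_smul (ψ q u) (primitive (adaptedL2 P ℱ)
        (mulIncr P f (w (q + 1))) T
        (iterIntegrand P ℱ f T w (fun l => (Icc t T).indicator (ψ l)) g (q + 1) r) u)]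
        with ω h1 h2
      rw [h1, h2, Pi.smul_apply, smul_eq_mul]
    constructor
    -- By induction every admissible inner version is determined almost surely at each time, so the
    -- outer integral does not depend on its choice.
    · rintro ⟨Z, hZ, hS⟩
      exact (isStochInt_iff hT hf _ ht hs.1 hs.2 hS.1 hR
        (hver Z fun u hu => (ih' u hu _).1 (hZ u hu))).1 hS
    · intro hJ
      -- Existence needs an inner integral that is jointly measurable and adapted; Hölder continuity
      -- of the indefinite integral provides one.
      obtain ⟨K, hD⟩ := exists_isL2Integrator hT hf (w (q + 1))
      obtain ⟨C, hC0, hC⟩ := exists_holder_primitive hD hR'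
      obtain ⟨Z, hZ, hZad, hZm⟩ := exists_measurable_version (primitive_mem hD hR') hC0 hC
      have hv := hver Z fun u _ => hZ u
      obtain ⟨M, hM⟩ := hR.exists_eLpNorm_le hv
      refine ⟨Z, fun u hu => (ih' u hu _).2 (hZ u), ?_⟩
      refine (isStochInt_iff hT hf _ ht hs.1 hs.2 ?_ hR hv).2 hJ
      refine InM2.of_bound hf ht hs.2 ?_ (fun u _ => (hZad u).const_mul _) hM
      have h1 : Measurable fun u : Icc t s => ψ q u :=
        (continuousOn_iff_continuous_domRestrict.1
          (hψq.mono (Icc_subset_Icc_right hs.2))).measurable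
      exact (h1.comp measurable_fst).mul (hZm.comp
        ((measurable_subtype_coe.comp measurable_fst).prodMk measurable_snd))

omit [IsProbabilityMeasure P] in
theorem InS2.isRegular {a b : ℝ} {φ : ℝ → Ω → ℝ} (h : InS2 P ℱ f a b φ) :
    IsRegular (adaptedL2 P ℱ) ((Icc a b).indicator fun s => toL2 P (φ s)) where
  toIsRiemann := by
    refine IsRiemann.of_continuousOn fun s hs => ?_
    rw [ContinuousWithinAt, tendsto_iff_edist_tendsto_0]
    refine (h.continuous s hs).congr' ?_
    filter_upwards [self_mem_nhdsWithin] with u hu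
    rw [edist_eq_enorm_sub, eLpNorm_sub_eq_enorm (coeFn_toL2 (h.inM2.memLp u hu)).symm
      (coeFn_toL2 (h.inM2.memLp s hs)).symm]
  adapted s := by
    by_cases hs : s ∈ Icc a b
    · rw [indicator_of_mem hs]
      exact toL2_mem (h.inM2.memLp s hs)
        (h.inM2.adapted s hs).stronglyMeasurable.aestronglyMeasurable
    · rw [indicator_of_notMem hs]; exact zero_mem _

end Combined

end IterIto

theorem theorem1 {Ω : Type*} [mΩ : MeasurableSpace Ω] (P : Measure Ω) [IsProbabilityMeasure P]
    (ℱ : Filtration ℝ mΩ) (f : ℝ → Ω → ℝ) (t T : ℝ) (ht : 0 ≤ t) (htT : t < T)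
    (hf : IterIto.IsWiener P ℱ T f)
    (k : ℕ) (hk : 1 ≤ k) (w : ℕ → IterIto.Integrator)
    (ψ : ℕ → ℝ → ℝ) (hψ : ∀ l, 1 ≤ l → l ≤ k → ContinuousOn (ψ l) (Icc t T))
    (φ : ℝ → Ω → ℝ) (hφ : IterIto.InS2 P ℱ f t T φ) :
    (∃ J, IterIto.IsIterInt P ℱ f φ ψ w t 1 k T J) ∧
    (∃ J', IterIto.IsHatJ P f φ ψ w t T k J') ∧
    (∀ J J', IterIto.IsIterInt P ℱ f φ ψ w t 1 k T J → IterIto.IsHatJ P f φ ψ w t T k J' →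
      J =ᵐ[P] J') := by
  open IterIto in
  have hT := ht.trans htT.le
  set ρ : ℕ → ℝ → ℝ := fun l => (Icc t T).indicator (ψ l) with hρdef
  set g : ℝ → Lp ℝ 2 P := (Icc t T).indicator fun s => toL2 P (φ s) with hgdef
  have hg : IsRegular (adaptedL2 P ℱ) g := hφ.isRegular
  have hφg : ∀ u ∈ Icc t T, φ u =ᵐ[P] g u := fun u hu => by
    rw [hgdef, indicator_of_mem hu]
    exact (coeFn_toL2 (hφ.inM2.memLp u hu)).symm
  have hg0 : ∀ u < t, g u = 0 := fun u hu =>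
    indicator_of_notMem (fun hu' => absurd hu'.1 (not_le.2 hu)) _
  have hρ : ∀ l, 1 ≤ l → l ≤ k → IsRiemann (ρ l) := fun l h1 h2 =>
    IsRiemann.of_continuousOn (hψ l h1 h2)
  have hJ : ∀ J, IsIterInt P ℱ f φ ψ w t 1 k T J ↔ J =ᵐ[P] (primitive (adaptedL2 P ℱ)
      (mulIncr P f (w 1)) T (iterIntegrand P ℱ f T w ρ g 1 k) T : Lp ℝ 2 P) := fun J =>
    isIterInt_iff ht htT.le hf hφ.inM2 hg hφg hg0 1 k
      (fun l h1 h2 => hψ l h1 (by omega)) (right_mem_Icc.2 htT.le)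
  have hI : ∀ u ∈ Icc t T, ∀ I, IsHatI P f ψ w T k u I ↔ I =ᵐ[P] hatInt P ℱ f T w ρ k u :=
    fun u hu I => isHatI_iff ht htT.le hf k hψ hu
  have hgt : (Ici t).indicator g = g := by
    rw [indicator_eq_self]
    intro u hu
    by_contra hu'
    exact hu (hg0 u (not_le.1 hu'))
  have hJ' : ∀ Z J, (∀ u ∈ Icc t T, IsHatI P f ψ w T k u (Z u)) →
      (IsCombinedInt P f (w (k + 1)) t T φ Z J ↔ J =ᵐ[P] outerInt P ℱ f T w ρ k g) :=
    fun Z J hZ => by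
      rw [isCombinedInt_iff hT hf k hρ hg ht htT.le hφg fun u hu => (hI u hu _).1 (hZ u hu), hgt]
  -- Both sides are the same iterated integral once the layers are unfolded. The remaining cutoff at
  -- T changes the outermost integrand only on a null set of times.
  have hmain : outerInt P ℱ f T w ρ k g = primitive (adaptedL2 P ℱ)
      (mulIncr P f (w 1)) T (iterIntegrand P ℱ f T w ρ g 1 k) T := by
    obtain ⟨K, hD⟩ := exists_isL2Integrator hT hf (w 1)
    have h1 : IsRegular (adaptedL2 P ℱ) (iterIntegrand P ℱ f T w ρ g 1 k) :=
      isRegular_iterIntegrand hT hf hg 1 k fun l h2 h3 => hρ l h2 (by omega)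
    have h2 := outerInt_iterIntegrand (P := P) (ℱ := ℱ) (f := f) (T := T) (w := w) (ρ := ρ) g k 0
    rw [add_zero] at h2
    refine h2.trans (ito_congr_ae hD (h1.indicator_Iio T) ?_)
    filter_upwards [Ico_ae_eq_restrict] with s hs
    rw [indicator_of_mem (show s ∈ Iio T from hs.2)]
  refine ⟨⟨_, (hJ _).2 (EventuallyEq.refl _ _)⟩, ?_, fun J J' h h' => ?_⟩
  · have hZ : ∀ u ∈ Icc t T, IsHatI P f ψ w T k u (hatInt P ℱ f T w ρ k u) := fun u hu =>
      (hI u hu _).2 (EventuallyEq.refl _ _)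
    exact ⟨_, _, hZ, (hJ' _ _ hZ).2 (EventuallyEq.refl _ _)⟩
  · obtain ⟨Z, hZ, hC⟩ := h'
    have h1 := (hJ J).1 h
    have h2 := (hJ' Z J' hZ).1 hC
    rw [hmain] at h2
    exact h1.trans h2.symm
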